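/- All logarithms are to base $2$. Let $\mathcal X,\mathcal Y,\mathcal Z$ be finite sets, where $\mathcal X$ carries a finite abelian group law $\oplus$ (for instance addition modulo $|\mathcal X|$), applied componentwise on $\mathcal X^n$. Let $(X,\tilde Y,\tilde Z)$ be a source with joint law $P_{X\tilde Y\tilde Z}$ on $\mathcal X\times\mathcal Y\times\mathcal Z$; Alice, Bob and Willie observe $X^n,\tilde Y^n,\tilde Z^n$, where the triples $(X_i,\tilde Y_i,\tilde Z_i)$ are i.i.d. A code of block length $n$ with key set of size $L$ works as follows. From $X^n$ and local randomness Alice produces a key $K\in\{1,\dots,L\}$ and a public message $\mathbf F\in\mathcal X^n$, which Bob and Willie observe without noise; from $\tilde Y^n$, $\mathbf F$ and local randomness Bob produces $\hat K\in\{1,\dots,L\}$. Let $Q_{\tilde Z^n\mathbf F}$ be the law of $(\tilde Z^n,U^n\oplus X^n)$, where $U^n$ is uniform on $\mathcal X^n$ and independent of the source (meaningless discussion). A number $R\ge 0$ is achievable if for every $\epsilon>0$ and all sufficiently large $n$ there is a code with $L=\lceil 2^{nR}\rceil$, $$\Pr(K\ne\hat K)\le\epsilon,\qquad \log L-H(K)\le\epsilon,\qquad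 D(P_{K\tilde Z^n\mathbf F}\,\|\,P_KP_{\tilde Z^n\mathbf F})+D(P_{\tilde Z^n\mathbf F}\,\|\,Q_{\tilde Z^n\mathbf F})\le\epsilon .$$ The stealthy secret key capacity $C_{SK}^{Eff}$ is the supremum of the achievable $R$. The conceptual wiretap codes are those in which, for some $L_1\geq 1$ and some codebook $u^n(m,w)\in\mathcal X^n$ ($1\le m\le L$, $1\le w\le L_1$), Alice draws $(m,w)$ uniformly and independently of the source and sets $K=m$, $\mathbf F=u^n(m,w)\oplus X^n$, and Bob decodes deterministically. **Theorem.** Suppose that the source $(X,\tilde Y,\tilde Z)$ is stochastically degraded: there is a source $(X,Y,Z)$ on the same alphabets, with the same law of $X$, such that $P_{\tilde Y|X}=P_{Y|X}$, $P_{\tilde Z|X}=P_{Z|X}$, and $X-Y-Z$ is a Markov chain. Then the stealthy secret key capacity of $(X,\tilde Y,\tilde Z)$ is $$C_{SK}^{Eff}=I(X;Y)-I(X;Z),$$ and this remains true when only conceptual wiretap codes are admitted in the definition of $C_{SK}^{Eff}$. -/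

import Mathlib

open scoped ENNReal

noncomputable section

namespace SSKG

/-! ### Finite probability and information measures (all logarithms to base 2) -/

/-- The law of `n` i.i.d. draws from `p`. -/
def iid {α : Type*} [Fintype α] (p : PMF α) (n : ℕ) : PMF (Fin n → α) :=
  PMF.ofFintype (fun s => ∏ i, p (s i)) (by
    have h1 : ∑ a, p a = 1 := by rw [← tsum_fintype (L := .unconditional α)]; exact p.tsum_coe
    have h := Finset.prod_univ_sum (fun _ : Fin n => (Finset.univ : Finset α)) (fun _ a => p a)
    simp only [h1, Finset.prod_const_one, Fintype.piFinset_univ] at h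
    exact h.symm)

/-- The product law `p × q`. -/
def prodLaw {α β : Type*} (p : PMF α) (q : PMF β) : PMF (α × β) :=
  p.bind fun a => q.map fun b => (a, b)

/-- The divergence `D(p‖q)` in bits, with value `∞` when `p` is not dominated by `q`. -/
def divergence {α : Type*} (p q : PMF α) : ℝ≥0∞ :=
  letI : MeasurableSpace α := ⊤
  InformationTheory.klDiv p.toMeasure q.toMeasure / ENNReal.ofReal (Real.log 2)

/-- The Shannon entropy in bits. -/
def entropy {α : Type*} [Fintype α] (p : PMF α) : ℝ :=
  ∑ a, Real.negMulLog (p a).toReal / Real.log 2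

/-- The mutual information in bits of a pair with joint law `p`. -/
def mutualInfo {α β : Type*} (p : PMF (α × β)) : ℝ :=
  (divergence p (prodLaw (p.map Prod.fst) (p.map Prod.snd))).toReal

/-- The conditional probability `P(b | a) = P(a, b) / P(a)` for a pair with joint law `p`
(it is `0` when `P(a) = 0`). -/
def condProb {α β : Type*} (p : PMF (α × β)) (b : β) (a : α) : ℝ≥0∞ :=
  p (a, b) / p.map Prod.fst a

/-! ### Sources of common randomness -/

section Source

variable {X Y Z : Type*}

/-- The marginal law of `X`. -/
def lawX (P : PMF (X × Y × Z)) : PMF X := P.map fun s => s.1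

/-- The marginal law of `Y`. -/
def lawY (P : PMF (X × Y × Z)) : PMF Y := P.map fun s => s.2.1

/-- The marginal law of `(X, Y)`. -/
def lawXY (P : PMF (X × Y × Z)) : PMF (X × Y) := P.map fun s => (s.1, s.2.1)

/-- The marginal law of `(X, Z)`. -/
def lawXZ (P : PMF (X × Y × Z)) : PMF (X × Z) := P.map fun s => (s.1, s.2.2)

/-- The marginal law of `(Y, Z)`. -/
def lawYZ (P : PMF (X × Y × Z)) : PMF (Y × Z) := P.map fun s => s.2

/-- Physical degradedness: `X - Y - Z` is a Markov chain. -/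
def PhysicallyDegraded (P : PMF (X × Y × Z)) : Prop :=
  ∀ x y z, P (x, y, z) * lawY P y = lawXY P (x, y) * lawYZ P (y, z)

/-- The source `(X, Ỹ, Z̃)` with law `P'` is stochastically degraded, as witnessed by the physically
degraded source `(X, Y, Z)` with law `P`: the law of `X` is the same, and
`P_{Ỹ|X} = P_{Y|X}`, `P_{Z̃|X} = P_{Z|X}`. -/
structure StochasticallyDegradedVia (P' P : PMF (X × Y × Z)) : Prop where
  physicallyDegraded : PhysicallyDegraded P
  lawX_eq : lawX P' = lawX P
  condY_eq : ∀ x y, condProb (lawXY P') y x = condProb (lawXY P) y x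
  condZ_eq : ∀ x z, condProb (lawXZ P') z x = condProb (lawXZ P) z x

end Source

/-! ### Key generation with forward public discussion -/

/-- A code of block length `n` with key set of size `L`. From her observation `xⁿ` and local
randomness Alice produces the key and the public discussion `f ∈ 𝒳ⁿ`; from his observation `yⁿ`,
the discussion and local randomness Bob produces his version of the key. -/
structure Code (X Y : Type*) (n L : ℕ) where
  enc : (Fin n → X) → PMF (Fin L × (Fin n → X))
  dec : (Fin n → Y) → (Fin n → X) → PMF (Fin L)

section Model

variable {X Y Z : Type*} [Fintype X] [Fintype Y] [Fintype Z] {n L : ℕ}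

/-- The joint law of `(K, Zⁿ, F, K̂)`. -/
def jointLaw (P : PMF (X × Y × Z)) (c : Code X Y n L) :
    PMF (Fin L × (Fin n → Z) × (Fin n → X) × Fin L) :=
  (iid P n).bind fun s =>
    (c.enc fun i => (s i).1).bind fun kf =>
      (c.dec (fun i => (s i).2.1) kf.2).map fun k' => (kf.1, fun i => (s i).2.2, kf.2, k')

/-- The law of the key `K`. -/
def keyLaw (P : PMF (X × Y × Z)) (c : Code X Y n L) : PMF (Fin L) :=
  (jointLaw P c).map fun w => w.1

/-- The law of `(K, (Zⁿ, F))`. -/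
def keyWillieLaw (P : PMF (X × Y × Z)) (c : Code X Y n L) :
    PMF (Fin L × (Fin n → Z) × (Fin n → X)) :=
  (jointLaw P c).map fun w => (w.1, w.2.1, w.2.2.1)

/-- The law `P_{Zⁿ F}` of Willie's observation. -/
def willieLaw (P : PMF (X × Y × Z)) (c : Code X Y n L) : PMF ((Fin n → Z) × (Fin n → X)) :=
  (jointLaw P c).map fun w => (w.2.1, w.2.2.1)

/-- The law `Q_{Zⁿ F}` of Willie's observation when the discussion is meaningless: in the conceptual
wiretap channel `u ↦ (Zⁿ, u ⊕ Xⁿ)` the input is uniform on `𝒳ⁿ` and independent of the source. -/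
def meaninglessLaw [AddCommGroup X] (P : PMF (X × Y × Z)) (n : ℕ) :
    PMF ((Fin n → Z) × (Fin n → X)) :=
  (iid P n).bind fun s =>
    (PMF.uniformOfFintype (Fin n → X)).map fun u =>
      (fun i => (s i).2.2, fun i => u i + (s i).1)

/-- The constraints on a code: error probability, uniformity of the key, and effective secrecy
(non-confusion plus non-stealth), each with tolerance `ε`. -/
structure Meets [AddCommGroup X] (P : PMF (X × Y × Z)) (c : Code X Y n L) (ε : ℝ) : Prop where
  error : (jointLaw P c).toOuterMeasure {w | w.1 ≠ w.2.2.2} ≤ ENNReal.ofReal ε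
  uniformity : Real.logb 2 L - entropy (keyLaw P c) ≤ ε
  effectiveSecrecy :
    divergence (keyWillieLaw P c) (prodLaw (keyLaw P c) (willieLaw P c)) +
      divergence (willieLaw P c) (meaninglessLaw P n) ≤ ENNReal.ofReal ε

end Model

/-- The codes given by the conceptual wiretap channel: for a codebook `u(m, w)` in `𝒳ⁿ`, Alice draws
`(m, w)` uniformly and independently of the source, takes the key `m`, and publishes
`u(m, w) ⊕ Xⁿ`; Bob decodes deterministically. -/
def IsConceptualWiretap {X Y : Type*} [AddCommGroup X] {n L : ℕ} (c : Code X Y n L) : Prop :=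
  ∃ (L₁ : ℕ) (_ : Nonempty (Fin L × Fin L₁)) (u : Fin L × Fin L₁ → Fin n → X)
    (g : (Fin n → Y) → (Fin n → X) → Fin L),
    (∀ x, c.enc x =
      (PMF.uniformOfFintype (Fin L × Fin L₁)).map fun mw => (mw.1, fun i => u mw i + x i)) ∧
    ∀ y f, c.dec y f = PMF.pure (g y f)

section Capacity

variable {X Y Z : Type*} [Fintype X] [Fintype Y] [Fintype Z] [AddCommGroup X]

/-- The rate `R` is achievable within the class `A` of codes: for every `ε > 0` and all large `n`
a code in `A` with key set of size `⌈2 ^ (n R)⌉` meets the constraints with tolerance `ε`. -/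
def Achievable (A : ∀ n L : ℕ, Set (Code X Y n L)) (P : PMF (X × Y × Z)) (R : ℝ) : Prop :=
  ∀ ε : ℝ, 0 < ε → ∃ n₀ : ℕ, ∀ n : ℕ, n₀ ≤ n →
    ∃ c ∈ A n ⌈(2 : ℝ) ^ ((n : ℝ) * R)⌉₊, Meets P c ε

/-- `C` is the stealthy secret key capacity of the source `P` over the class `A` of codes. -/
def IsStealthyKeyCapacity (A : ∀ n L : ℕ, Set (Code X Y n L)) (P : PMF (X × Y × Z)) (C : ℝ) :
    Prop :=
  IsLUB {R : ℝ | 0 ≤ R ∧ Achievable A P R} C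

end Capacity

end SSKG

end

open scoped ENNReal

noncomputable section

namespace SSKG

/-! ### Expectations on finite probability spaces -/

section Support

variable {α β : Type*}

/-! Error probability, key law and Willie's law depend on the source only through the laws of (X, Y)
and (X, Z) (`error_eq`, `keyWillieLaw_eq`), so a stochastically degraded source may be replaced by
the physically degraded one.

Converse. H(K) = I(K; Zⁿ, F) + H(K | Zⁿ, F), and secrecy makes the first term small. For a Markov
chain X - Y - Z, `equivocation_le` bounds the second by I(Xⁿ; Yⁿ | Zⁿ) plus Bob's Fano term. Its
proof is one application of Gibbs' inequality: reweighting the source so that Y is generated from Z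
alone leaves Bob no better off than Willie, which is the bound E r ≤ 1 of `sum_ratio_le_one`. It is
applied to the whole block as a single letter; the log-ratio whose mean is I(X; Y) - I(X; Z) is
additive over the block.

Achievability. Hiding u behind X gives a channel u ↦ (Y, u + X) with additive noise in a group,
whose likelihood ratio depends on f - u only. In a uniform random codebook, differences of distinct
codewords are uniform, and this pairwise property suffices for both bounds: threshold decoding
(`expect_errorProb_le`) succeeds when the codebook rate is below E log ratio = log |X| - H(X | Y),
and soft covering (`expect_secrecyLoss_le`) succeeds when the rate of the randomization w is above
log |X| - H(X | Z). The gap is I(X; Y) - I(X; Z). Both bounds are fractional moments, which factor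
over blocks and are below one per letter by `exists_expect_rpow_lt_one`. The key is exactly uniform,
and the two secrecy divergences sum to the single quantity that soft covering controls
(`secrecyLoss_eq`). -/

lemma toReal_pos_of_ne_zero {p : PMF α} {a : α} (h : p a ≠ 0) : 0 < (p a).toReal :=
  ENNReal.toReal_pos h (p.apply_ne_top a)

lemma ne_zero_of_toReal_ne_zero {p : PMF α} {a : α} (h : (p a).toReal ≠ 0) : p a ≠ 0 :=
  fun h0 => h (by simp [h0])

lemma map_apply_ne_zero (p : PMF α) (g : α → β) {a : α} (h : p a ≠ 0) : p.map g (g a) ≠ 0 := by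
  rw [← PMF.mem_support_iff, PMF.mem_support_map_iff]
  exact ⟨a, h, rfl⟩

end Support

section Expectation

variable {α β : Type*} [Fintype α] [Fintype β]

/-- The expectation of `φ` under the law `p`. -/
def expect (p : PMF α) (φ : α → ℝ) : ℝ := ∑ a, (p a).toReal * φ a

lemma sum_toReal_eq_one (p : PMF α) : ∑ a, (p a).toReal = 1 := by
  rw [← ENNReal.toReal_sum fun a _ => p.apply_ne_top a, ← tsum_fintype (L := .unconditional α),
    p.tsum_coe, ENNReal.toReal_one]

lemma expect_congr {p : PMF α} {φ ψ : α → ℝ} (h : ∀ a, p a ≠ 0 → φ a = ψ a) :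
    expect p φ = expect p ψ := by
  refine Finset.sum_congr rfl fun a _ => ?_
  by_cases ha : p a = 0
  · simp [ha]
  · rw [h a ha]

lemma expect_mono {p : PMF α} {φ ψ : α → ℝ} (h : ∀ a, p a ≠ 0 → φ a ≤ ψ a) :
    expect p φ ≤ expect p ψ := by
  refine Finset.sum_le_sum fun a _ => ?_
  by_cases ha : p a = 0
  · simp [ha]
  · exact mul_le_mul_of_nonneg_left (h a ha) ENNReal.toReal_nonneg

lemma expect_const (p : PMF α) (c : ℝ) : expect p (fun _ => c) = c := by
  rw [expect, ← Finset.sum_mul, sum_toReal_eq_one, one_mul]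

lemma expect_add (p : PMF α) (φ ψ : α → ℝ) :
    expect p (fun a => φ a + ψ a) = expect p φ + expect p ψ := by
  simp only [expect, mul_add, Finset.sum_add_distrib]

lemma expect_sub (p : PMF α) (φ ψ : α → ℝ) :
    expect p (fun a => φ a - ψ a) = expect p φ - expect p ψ := by
  simp only [expect, mul_sub, Finset.sum_sub_distrib]

lemma expect_neg (p : PMF α) (φ : α → ℝ) : expect p (fun a => -φ a) = -expect p φ := by
  simp only [expect, mul_neg, Finset.sum_neg_distrib]

lemma expect_const_mul (p : PMF α) (c : ℝ) (φ : α → ℝ) :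
    expect p (fun a => c * φ a) = c * expect p φ := by
  simp only [expect, Finset.mul_sum, mul_left_comm]

lemma expect_sum {ι : Type*} (s : Finset ι) (p : PMF α) (φ : ι → α → ℝ) :
    expect p (fun a => ∑ i ∈ s, φ i a) = ∑ i ∈ s, expect p (φ i) := by
  simp only [expect, Finset.mul_sum]
  exact Finset.sum_comm

lemma expect_nonneg {p : PMF α} {φ : α → ℝ} (h : ∀ a, p a ≠ 0 → 0 ≤ φ a) : 0 ≤ expect p φ := by
  simpa [expect_const] using expect_mono (φ := fun _ => (0 : ℝ)) h

lemma expect_comm (p : PMF α) (q : PMF β) (φ : α → β → ℝ) :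
    expect p (fun a => expect q (φ a)) = expect q fun b => expect p fun a => φ a b := by
  simp only [expect, Finset.mul_sum, mul_left_comm]
  exact Finset.sum_comm

lemma exists_le_of_expect_le {p : PMF α} {φ : α → ℝ} {c : ℝ} (h : expect p φ ≤ c) :
    ∃ a, φ a ≤ c := by
  by_contra! hc
  obtain ⟨a, ha⟩ := p.support_nonempty
  have h1 : ∑ a, (p a).toReal * c < ∑ a, (p a).toReal * φ a :=
    Finset.sum_lt_sum (fun b _ => mul_le_mul_of_nonneg_left (hc b).le ENNReal.toReal_nonneg)
      ⟨a, Finset.mem_univ a, mul_lt_mul_of_pos_left (hc a)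
        (toReal_pos_of_ne_zero ((p.mem_support_iff a).1 ha))⟩
  have h2 := expect_const p c
  simp only [expect] at h h2
  linarith

lemma expect_pure (a : α) (φ : α → ℝ) : expect (PMF.pure a) φ = φ a := by
  classical
  rw [expect, Finset.sum_eq_single a]
  · simp
  · intro b _ hb
    simp [PMF.pure_apply_of_ne _ _ hb]
  · simp

lemma expect_bind (p : PMF α) (f : α → PMF β) (φ : β → ℝ) :
    expect (p.bind f) φ = expect p fun a => expect (f a) φ := by
  simp only [expect, PMF.bind_apply, tsum_fintype, Finset.mul_sum]
  rw [Finset.sum_comm]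
  refine Finset.sum_congr rfl fun b _ => ?_
  rw [ENNReal.toReal_sum fun a _ => ENNReal.mul_ne_top (p.apply_ne_top a) ((f a).apply_ne_top b),
    Finset.sum_mul]
  simp only [ENNReal.toReal_mul, mul_assoc]

lemma expect_map (p : PMF α) (g : α → β) (φ : β → ℝ) :
    expect (p.map g) φ = expect p fun a => φ (g a) := by
  rw [← PMF.bind_pure_comp, expect_bind]
  simp only [Function.comp, expect_pure]

lemma expect_uniform [Nonempty α] (φ : α → ℝ) :
    expect (PMF.uniformOfFintype α) φ = (Fintype.card α : ℝ)⁻¹ * ∑ a, φ a := by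
  simp [expect, Finset.mul_sum]

open Classical in
lemma toReal_apply_eq_expect (p : PMF α) (a : α) :
    (p a).toReal = expect p fun b => if b = a then 1 else 0 := by
  simp [expect]

open Classical in
lemma toReal_map_apply (p : PMF α) (g : α → β) (b : β) :
    (p.map g b).toReal = expect p fun a => if g a = b then 1 else 0 := by
  rw [toReal_apply_eq_expect, expect_map]

lemma toReal_map_snd_apply (p : PMF (α × β)) (b : β) :
    (p.map Prod.snd b).toReal = ∑ a, (p (a, b)).toReal := by
  classical
  rw [toReal_map_apply, expect, Fintype.sum_prod_type_right, Finset.sum_eq_single b]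
  · simp
  · intro c _ hc
    simp [hc]
  · simp

lemma prodLaw_apply (p : PMF α) (q : PMF β) (a : α) (b : β) : prodLaw p q (a, b) = p a * q b := by
  classical
  rw [← ENNReal.toReal_eq_toReal_iff' (PMF.apply_ne_top _ _)
    (ENNReal.mul_ne_top (PMF.apply_ne_top _ _) (PMF.apply_ne_top _ _)), toReal_apply_eq_expect,
    prodLaw, expect_bind, ENNReal.toReal_mul]
  simp only [expect_map]
  simp only [expect, Prod.mk.injEq]
  rw [Finset.sum_eq_single a]
  · simp
  · intro c _ hc
    simp [hc]
  · simp

/-- Gibbs' inequality in the form `E log r ≤ 0` whenever `E r ≤ 1`. -/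
lemma expect_log_nonpos {p : PMF α} {r : α → ℝ} (hr : ∀ a, p a ≠ 0 → 0 < r a)
    (h : expect p r ≤ 1) : expect p (fun a => Real.log (r a)) ≤ 0 := by
  have h1 := expect_mono (p := p) (ψ := fun a => r a - 1)
    fun a ha => Real.log_le_sub_one_of_pos (hr a ha)
  rw [expect_sub, expect_const] at h1
  linarith

end Expectation

/-! ### Divergence as a finite sum -/

section Divergence

variable {α β : Type*} [Fintype α] [Fintype β]

/-- The relative entropy in nats, as a finite sum. -/
def relEntropy (p q : PMF α) : ℝ :=
  expect p fun a => Real.log ((p a).toReal / (q a).toReal)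

lemma relEntropy_nonneg {p q : PMF α} (h : ∀ a, p a ≠ 0 → q a ≠ 0) : 0 ≤ relEntropy p q := by
  have h1 : expect p (fun a => Real.log ((q a).toReal / (p a).toReal)) ≤ 0 := by
    refine expect_log_nonpos (fun a ha => div_pos (toReal_pos_of_ne_zero (h a ha))
      (toReal_pos_of_ne_zero ha)) ?_
    -- The mean of q/p under p is the q-mass of the support of p.
    rw [← sum_toReal_eq_one q]
    refine Finset.sum_le_sum fun a _ => ?_
    by_cases ha : p a = 0
    · simp [ha]
    · rw [mul_div_cancel₀ _ (toReal_pos_of_ne_zero ha).ne']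
  have h2 : relEntropy p q = -expect p (fun a => Real.log ((q a).toReal / (p a).toReal)) := by
    rw [relEntropy, ← expect_neg]
    refine expect_congr fun a _ => ?_
    rw [← Real.log_inv, inv_div]
  linarith

lemma divergence_eq_ofReal {p q : PMF α} (h : ∀ a, p a ≠ 0 → q a ≠ 0) :
    divergence p q = ENNReal.ofReal (relEntropy p q / Real.log 2) := by
  let _ : MeasurableSpace α := ⊤
  have hm : ∀ s : Set α, MeasurableSet s := fun _ => trivial
  have _ : MeasurableSingletonClass α := ⟨fun _ => trivial⟩
  have hac : p.toMeasure.AbsolutelyContinuous q.toMeasure := by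
    intro s hs
    rw [PMF.toMeasure_apply_eq_zero_iff _ (hm _)] at hs ⊢
    exact hs.mono_left fun a ha => h a ha
  have hint : MeasureTheory.Integrable (MeasureTheory.llr p.toMeasure q.toMeasure) p.toMeasure :=
    MeasureTheory.Integrable.of_finite
  have hk : InformationTheory.klDiv p.toMeasure q.toMeasure =
      ENNReal.ofReal (relEntropy p q) := by
    rw [InformationTheory.klDiv_of_ac_of_integrable hac hint]
    congr 1
    simp only [MeasureTheory.probReal_univ, add_sub_cancel_right]
    rw [PMF.integral_eq_sum]
    refine expect_congr fun a ha => ?_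
    -- Integrating the density over a singleton identifies it with the ratio of point masses.
    have h1 := MeasureTheory.Measure.setLIntegral_rnDeriv hac {a}
    rw [MeasureTheory.lintegral_singleton, PMF.toMeasure_apply_singleton _ _ (hm _),
      PMF.toMeasure_apply_singleton _ _ (hm _)] at h1
    rw [MeasureTheory.llr, ← h1, ENNReal.toReal_mul,
      mul_div_cancel_right₀ _ (toReal_pos_of_ne_zero (h a ha)).ne']
  rw [divergence, hk, ENNReal.ofReal_div_of_pos (Real.log_pos one_lt_two)]

lemma mutualInfo_eq (p : PMF (α × β)) :
    mutualInfo p = expect p (fun s => Real.log ((p s).toReal /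
      ((p.map Prod.fst s.1).toReal * (p.map Prod.snd s.2).toReal))) / Real.log 2 := by
  have h : ∀ s, p s ≠ 0 → prodLaw (p.map Prod.fst) (p.map Prod.snd) s ≠ 0 := by
    rintro ⟨a, b⟩ hs
    rw [prodLaw_apply]
    exact mul_ne_zero (map_apply_ne_zero p Prod.fst hs) (map_apply_ne_zero p Prod.snd hs)
  rw [mutualInfo, divergence_eq_ofReal h, ENNReal.toReal_ofReal
    (div_nonneg (relEntropy_nonneg h) (Real.log_nonneg one_le_two)), relEntropy]
  congr 2
  funext s
  rw [← Prod.mk.eta (p := s), prodLaw_apply, ENNReal.toReal_mul]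

/-- The divergence from independence plus a divergence of the second marginal is the divergence
from a product law. -/
lemma relEntropy_prodLaw_add {p : PMF (α × β)} {q : PMF β}
    (h : ∀ b, p.map Prod.snd b ≠ 0 → q b ≠ 0) :
    relEntropy p (prodLaw (p.map Prod.fst) (p.map Prod.snd)) + relEntropy (p.map Prod.snd) q =
      expect p fun s => Real.log ((p s).toReal / ((p.map Prod.fst s.1).toReal * (q s.2).toReal)) := by
  rw [relEntropy, relEntropy, expect_map, ← expect_add]
  refine expect_congr fun s hs => ?_
  have h1 := toReal_pos_of_ne_zero hs
  have h2 := toReal_pos_of_ne_zero (map_apply_ne_zero p Prod.fst hs)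
  have h3 := toReal_pos_of_ne_zero (map_apply_ne_zero p Prod.snd hs)
  have h4 := toReal_pos_of_ne_zero (h _ (map_apply_ne_zero p Prod.snd hs))
  obtain ⟨a, b⟩ := s
  rw [prodLaw_apply, ENNReal.toReal_mul, ← Real.log_mul (by positivity) (by positivity)]
  congr 1
  dsimp only at *
  field_simp

end Divergence

/-! ### Powers of a pair -/

section Powers

variable {α β : Type*} [Fintype α] [Fintype β]

lemma toReal_iid_apply (p : PMF α) (n : ℕ) (s : Fin n → α) :
    (iid p n s).toReal = ∏ i, (p (s i)).toReal := by
  rw [iid, PMF.ofFintype_apply, ENNReal.toReal_prod]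

lemma expect_iid_prod (p : PMF α) (n : ℕ) (φ : α → ℝ) :
    expect (iid p n) (fun s => ∏ i, φ (s i)) = expect p φ ^ n := by
  classical
  have h := Finset.prod_univ_sum (fun _ : Fin n => (Finset.univ : Finset α))
    (fun _ a => (p a).toReal * φ a)
  rw [Finset.prod_const, Finset.card_univ, Fintype.card_fin, Fintype.piFinset_univ] at h
  simp only [expect, toReal_iid_apply, ← Finset.prod_mul_distrib, h]

lemma iid_map (p : PMF α) (g : α → β) (n : ℕ) :
    (iid p n).map (fun s i => g (s i)) = iid (p.map g) n := by
  classical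
  ext t
  rw [← ENNReal.toReal_eq_toReal_iff' (PMF.apply_ne_top _ _) (PMF.apply_ne_top _ _),
    toReal_map_apply, toReal_iid_apply]
  simp only [toReal_map_apply, expect, toReal_iid_apply]
  rw [Finset.prod_univ_sum, Fintype.piFinset_univ]
  refine Finset.sum_congr rfl fun s _ => ?_
  rw [Finset.prod_mul_distrib]
  congr 1
  rw [Finset.prod_ite_zero]
  simp [funext_iff]

lemma expect_iid_eval (p : PMF α) (n : ℕ) (i : Fin n) (φ : α → ℝ) :
    expect (iid p n) (fun s => φ (s i)) = expect p φ := by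
  classical
  have h1 : (iid p n).map (fun s => s i) = p := by
    ext t
    rw [← ENNReal.toReal_eq_toReal_iff' (PMF.apply_ne_top _ _) (PMF.apply_ne_top _ _),
      toReal_map_apply]
    simp only [expect, toReal_iid_apply]
    -- The indicator of one coordinate is written as a product over all coordinates, so that the sum
    -- over sequences factors.
    have h2 : ∀ s : Fin n → α, (∏ j, (p (s j)).toReal) * (if s i = t then (1 : ℝ) else 0) =
        ∏ j, (p (s j)).toReal * (if j = i → s j = t then (1 : ℝ) else 0) := by
      intro s
      rw [Finset.prod_mul_distrib, Finset.prod_ite_zero]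
      simp
    simp only [h2]
    have h3 := Finset.prod_univ_sum (fun _ : Fin n => (Finset.univ : Finset α))
      (fun j a => (p a).toReal * (if j = i → a = t then (1 : ℝ) else 0))
    rw [Fintype.piFinset_univ] at h3
    rw [← h3, Finset.prod_eq_single i]
    · simp
    · intro j _ hj
      simp [hj, sum_toReal_eq_one]
    · simp
  rw [← expect_map (iid p n) (fun s => s i), h1]

/-- The law of the pair of sequences of `n` i.i.d. pairs. -/
def pairPow (p : PMF (α × β)) (n : ℕ) : PMF ((Fin n → α) × (Fin n → β)) :=
  (iid p n).map fun s => (fun i => (s i).1, fun i => (s i).2)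

lemma toReal_pairPow_apply (p : PMF (α × β)) (n : ℕ) (s : (Fin n → α) × (Fin n → β)) :
    (pairPow p n s).toReal = ∏ i, (p (s.1 i, s.2 i)).toReal := by
  classical
  rw [pairPow, toReal_map_apply, expect, Finset.sum_eq_single fun i => (s.1 i, s.2 i)]
  · simp [toReal_iid_apply]
  · intro t _ ht
    rw [if_neg, mul_zero]
    rintro rfl
    exact ht rfl
  · simp

lemma pairPow_map_snd (p : PMF (α × β)) (n : ℕ) :
    (pairPow p n).map Prod.snd = iid (p.map Prod.snd) n := by
  rw [pairPow, PMF.map_comp, ← iid_map]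
  rfl

lemma expect_pairPow_prod (p : PMF (α × β)) (n : ℕ) (φ : α × β → ℝ) :
    expect (pairPow p n) (fun s => ∏ i, φ (s.1 i, s.2 i)) = expect p φ ^ n := by
  rw [pairPow, expect_map, ← expect_iid_prod]

end Powers

/-! ### Equivocation for a degraded source -/

section Laws

variable {A B D K F : Type*}

/-- The law of `(K, Z, F)` when `(K, F)` is produced from `X` by `e`. -/
def observedLaw (p : PMF (A × D)) (e : A → PMF (K × F)) : PMF (K × D × F) :=
  p.bind fun s => (e s.1).map fun kf => (kf.1, s.2, kf.2)

lemma observedLaw_apply_ne_zero {p : PMF (A × D)} {e : A → PMF (K × F)} {s : A × D} {kf : K × F}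
    (hs : p s ≠ 0) (hkf : e s.1 kf ≠ 0) : observedLaw p e (kf.1, s.2, kf.2) ≠ 0 := by
  rw [observedLaw, ← PMF.mem_support_iff, PMF.mem_support_bind_iff]
  exact ⟨s, hs, map_apply_ne_zero (e s.1) (fun kf => (kf.1, s.2, kf.2)) hkf⟩

lemma law_apply_ne_zero (p : PMF (A × B × D)) {s : A × B × D} (hs : p s ≠ 0) :
    lawXY p (s.1, s.2.1) ≠ 0 ∧ lawXZ p (s.1, s.2.2) ≠ 0 ∧ lawY p s.2.1 ≠ 0 ∧
      (lawXZ p).map Prod.snd s.2.2 ≠ 0 :=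
  have h := map_apply_ne_zero p (fun s => (s.1, s.2.2)) hs
  ⟨map_apply_ne_zero p (fun s => (s.1, s.2.1)) hs, h, map_apply_ne_zero p (fun s => s.2.1) hs,
    map_apply_ne_zero (lawXZ p) Prod.snd h⟩

lemma toReal_sum_lawYZ [Fintype B] [Fintype D] (p : PMF (A × B × D)) (z : D) :
    ∑ y, (lawYZ p (y, z)).toReal = ((lawXZ p).map Prod.snd z).toReal := by
  have h : (lawXZ p).map Prod.snd = (lawYZ p).map Prod.snd := by
    rw [lawXZ, lawYZ, PMF.map_comp, PMF.map_comp]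
    rfl
  rw [h, toReal_map_snd_apply]

/-- The change of measure from the source to the one in which `Y` depends on `X` through `Z`. -/
lemma PhysicallyDegraded.mul_ratio_le {p : PMF (A × B × D)}
    (hp : PhysicallyDegraded p) (x : A) (y : B) (z : D) :
    (p (x, y, z)).toReal * ((lawY p y).toReal * (lawXZ p (x, z)).toReal /
      ((lawXY p (x, y)).toReal * ((lawXZ p).map Prod.snd z).toReal)) ≤
      (lawYZ p (y, z)).toReal * (lawXZ p (x, z)).toReal /
        ((lawXZ p).map Prod.snd z).toReal := by
  -- Off the support the left side vanishes while the right side may not; elsewhere equality holds.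
  by_cases hs : p (x, y, z) = 0
  · rw [hs, ENNReal.toReal_zero, zero_mul]
    positivity
  obtain ⟨h1, h2, h3, h4⟩ := law_apply_ne_zero p hs
  have h := congrArg ENNReal.toReal (hp x y z)
  rw [ENNReal.toReal_mul, ENNReal.toReal_mul] at h
  have h1' := toReal_pos_of_ne_zero h1
  have h4' := toReal_pos_of_ne_zero h4
  dsimp only at h1' h4'
  refine le_of_eq ?_
  field_simp
  linear_combination (lawXZ p (x, z)).toReal * h

end Laws

section Converse

variable {A B D K F : Type*} [Fintype A] [Fintype B] [Fintype D] [Fintype K] [Fintype F]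

/-- The probability that the decoded key differs from the key. -/
def errorProb (p : PMF (A × B)) (e : A → PMF (K × F)) (d : B → F → PMF K) : ℝ :=
  open Classical in
  expect p fun s => expect (e s.1) fun kf => expect (d s.2 kf.2) fun k' =>
    if kf.1 ≠ k' then 1 else 0

lemma expect_observedLaw (p : PMF (A × D)) (e : A → PMF (K × F)) (φ : K × D × F → ℝ) :
    expect (observedLaw p e) φ = expect p fun s => expect (e s.1) fun kf => φ (kf.1, s.2, kf.2) := by
  simp only [observedLaw, expect_bind, expect_map]

lemma toReal_observedLaw_apply (p : PMF (A × D)) (e : A → PMF (K × F)) (k : K) (z : D) (f : F) :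
    (observedLaw p e (k, z, f)).toReal = ∑ x, (p (x, z)).toReal * (e x (k, f)).toReal := by
  classical
  rw [toReal_apply_eq_expect, expect_observedLaw, expect, Fintype.sum_prod_type]
  refine Finset.sum_congr rfl fun x _ => ?_
  rw [Finset.sum_eq_single z]
  · congr 1
    rw [toReal_apply_eq_expect]
    simp only [true_and, Prod.ext_iff]
  · intro z' _ hz
    simp [hz, expect_const]
  · simp

lemma errorProb_eq [DecidableEq K] (p : PMF (A × B)) (e : A → PMF (K × F)) (d : B → F → PMF K) :
    errorProb p e d =
      expect p fun s => expect (e s.1) fun kf => 1 - (d s.2 kf.2 kf.1).toReal := by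
  rw [errorProb]
  congr 1; funext s
  congr 1; funext kf
  rw [toReal_apply_eq_expect, ← expect_const (d s.2 kf.2) 1, ← expect_sub]
  simp only [expect_const]
  congr 1; funext k'
  by_cases h : kf.1 = k'
  · simp [h]
  · simp [h, Ne.symm h]

lemma sum_rotate (t : A × B × D → K × F → ℝ) :
    ∑ s, ∑ kf, t s kf = ∑ z, ∑ f, ∑ y, ∑ k, ∑ x, t (x, y, z) (k, f) := by
  simp only [← Fintype.sum_prod_type']
  exact Fintype.sum_equiv
    { toFun := fun v => (v.1.2.2, v.2.2, v.1.2.1, v.2.1, v.1.1)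
      invFun := fun v => ((v.2.2.2.2, v.2.2.1, v.1), (v.2.2.2.1, v.2.1))
      left_inv := fun _ => rfl
      right_inv := fun _ => rfl } _ _ fun _ => rfl

/-- The estimate behind Fano's inequality, for a decoder mixed with the uniform law. -/
lemma neg_log_decoder_mixture_le {δ l : ℝ} (h0 : 0 ≤ δ) (h1 : δ ≤ 1) (hl : 1 ≤ l) :
    -Real.log (δ + (1 - δ) / l) ≤ (1 - δ) * Real.log l := by
  have hl0 : 0 < l := by linarith
  have hc := strictConcaveOn_log_Ioi.concaveOn.2 (x := 1) (y := l⁻¹) (by simp)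
    (by simpa using hl0) h0 (by linarith : 0 ≤ 1 - δ) (by ring)
  simp only [smul_eq_mul, Real.log_one, mul_zero, mul_one, zero_add, Real.log_inv] at hc
  rw [div_eq_mul_inv]
  linarith

variable {p : PMF (A × B × D)}

/-- The second factor replaces P(x, y, z) by P(y | z) P(x, z). Summing over x then produces the law
of (k, z, f), which cancels the denominator of the first factor and leaves P(y | z) P(z, f) q(y, f,
k). This has total mass at most one because q is a subprobability in k. Under the new measure Y
carries nothing about K beyond Willie's observation. -/
lemma sum_ratio_le_one (hp : PhysicallyDegraded p) (e : A → PMF (K × F)) (q : B → F → K → ℝ)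
    (hq : ∀ y f k, 0 ≤ q y f k) (hq1 : ∀ y f, ∑ k, q y f k ≤ 1) :
    (expect p fun s => expect (e s.1) fun kf =>
      ((observedLaw (lawXZ p) e).map Prod.snd (s.2.2, kf.2)).toReal /
          (observedLaw (lawXZ p) e (kf.1, s.2.2, kf.2)).toReal *
        ((lawY p s.2.1).toReal * (lawXZ p (s.1, s.2.2)).toReal /
          ((lawXY p (s.1, s.2.1)).toReal * ((lawXZ p).map Prod.snd s.2.2).toReal)) *
        q s.2.1 kf.2 kf.1) ≤ 1 := by
  simp only [expect, Finset.mul_sum]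
  rw [sum_rotate, ← sum_toReal_eq_one ((observedLaw (lawXZ p) e).map Prod.snd),
    Fintype.sum_prod_type]
  refine Finset.sum_le_sum fun z _ => Finset.sum_le_sum fun f _ => ?_
  dsimp only
  set V := ((observedLaw (lawXZ p) e).map Prod.snd (z, f)).toReal with hV
  have hV0 : 0 ≤ V := ENNReal.toReal_nonneg
  set c := ((lawXZ p).map Prod.snd z).toReal with hc
  have hc0 : 0 ≤ c := ENNReal.toReal_nonneg
  calc _ ≤ ∑ y, ∑ k, (lawYZ p (y, z)).toReal / c * V * q y f k := by
        refine Finset.sum_le_sum fun y _ => Finset.sum_le_sum fun k _ => ?_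
        set W := (observedLaw (lawXZ p) e (k, z, f)).toReal with hW
        have hW0 : 0 ≤ W := ENNReal.toReal_nonneg
        calc _ ≤ ∑ x, (lawYZ p (y, z)).toReal / c * (V / W) * q y f k *
                ((lawXZ p (x, z)).toReal * (e x (k, f)).toReal) := by
              refine Finset.sum_le_sum fun x _ => ?_
              have h := mul_le_mul_of_nonneg_right (hp.mul_ratio_le x y z)
                (by have := hq y f k; positivity :
                  0 ≤ (e x (k, f)).toReal * (V / W) * q y f k)
              calc _ = _ := by ring
                _ ≤ _ := h
                _ = _ := by ring
          _ = (lawYZ p (y, z)).toReal / c * q y f k * (V / W * W) := by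
              rw [← Finset.mul_sum, ← toReal_observedLaw_apply, ← hW]
              ring
          _ ≤ (lawYZ p (y, z)).toReal / c * q y f k * V := by
              have := hq y f k
              refine mul_le_mul_of_nonneg_left ?_ (by positivity)
              by_cases h : W = 0
              · simpa [h] using hV0
              · rw [div_mul_cancel₀ _ h]
          _ = _ := by ring
    _ ≤ ∑ y, (lawYZ p (y, z)).toReal / c * V := by
        refine Finset.sum_le_sum fun y _ => ?_
        rw [← Finset.mul_sum]
        exact mul_le_of_le_one_right (by positivity) (hq1 y f)
    _ = c / c * V := by
        rw [← Finset.sum_mul, ← Finset.sum_div, toReal_sum_lawYZ]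
    _ ≤ V := mul_le_of_le_one_left hV0 (div_self_le_one c)

/-- Willie's equivocation about the key exceeds the conditional information `I(X; Y | Z)` by at
most Bob's equivocation, which is bounded as in Fano's inequality. -/
theorem equivocation_le (hp : PhysicallyDegraded p) (e : A → PMF (K × F)) (d : B → F → PMF K) :
    -expect (observedLaw (lawXZ p) e) (fun w => Real.log ((observedLaw (lawXZ p) e w).toReal /
        ((observedLaw (lawXZ p) e).map Prod.snd w.2).toReal)) ≤
      expect p (fun s => Real.log ((lawXY p (s.1, s.2.1)).toReal *
        ((lawXZ p).map Prod.snd s.2.2).toReal /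
          ((lawY p s.2.1).toReal * (lawXZ p (s.1, s.2.2)).toReal))) + Real.log 2 +
        errorProb (lawXY p) e d * Real.log (Fintype.card K) := by
  classical
  have : Nonempty K := by
    obtain ⟨s, _⟩ := p.support_nonempty
    obtain ⟨kf, _⟩ := (e s.1).support_nonempty
    exact ⟨kf.1⟩
  set l : ℝ := (Fintype.card K : ℝ) with hl
  have hl1 : 1 ≤ l := Nat.one_le_cast.2 Fintype.card_pos
  have hl0 : 0 < l := by linarith
  -- The decoder is mixed with the uniform law to keep its logarithm finite. The total mass of q is
  -- at most 2; halving it costs the `Real.log 2` of Fano's inequality.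
  set q : B → F → K → ℝ := fun y f k => (d y f k).toReal + (1 - (d y f k).toReal) / l with hqdef
  have hd1 : ∀ y f k, (d y f k).toReal ≤ 1 := fun y f k => by
    simpa using ENNReal.toReal_mono ENNReal.one_ne_top ((d y f).coe_le_one k)
  have hq0 : ∀ y f k, 0 < q y f k := fun y f k => by
    have h1 := hd1 y f k
    rcases (ENNReal.toReal_nonneg (a := d y f k)).eq_or_lt with h | h
    · simp only [hqdef, ← h]
      simpa using hl0
    · have : 0 ≤ (1 - (d y f k).toReal) / l := div_nonneg (by linarith) hl0.le
      simp only [hqdef]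
      linarith
  have hq1 : ∀ y f, ∑ k, q y f k / 2 ≤ 1 := fun y f => by
    rw [← Finset.sum_div]
    simp only [hqdef, Finset.sum_add_distrib, ← Finset.sum_div, Finset.sum_sub_distrib,
      sum_toReal_eq_one, Finset.sum_const, Finset.card_univ, nsmul_eq_mul, mul_one, ← hl]
    have : (l - 1) / l ≤ 1 := by rw [div_le_one hl0]; linarith
    linarith
  have hmain := sum_ratio_le_one hp e (fun y f k => q y f k / 2)
    (fun y f k => (half_pos (hq0 y f k)).le) hq1
  -- This is log r ≤ r - 1 averaged, with r the weight of `sum_ratio_le_one`; hence the added 1 and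
  -- the bound 1.
  have hpoint : (expect p fun s => expect (e s.1) fun kf =>
      (-Real.log ((observedLaw (lawXZ p) e (kf.1, s.2.2, kf.2)).toReal /
        ((observedLaw (lawXZ p) e).map Prod.snd (s.2.2, kf.2)).toReal) -
      Real.log ((lawXY p (s.1, s.2.1)).toReal * ((lawXZ p).map Prod.snd s.2.2).toReal /
          ((lawY p s.2.1).toReal * (lawXZ p (s.1, s.2.2)).toReal)) - Real.log 2 -
      (1 - (d s.2.1 kf.2 kf.1).toReal) * Real.log l + 1)) ≤ 1 := by
    refine le_trans (expect_mono fun s hs => expect_mono fun kf hkf => ?_) hmain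
    obtain ⟨h1, h2, h3, h4⟩ := law_apply_ne_zero p hs
    have h5 := observedLaw_apply_ne_zero (s := (s.1, s.2.2)) h2 hkf
    have h6 := toReal_pos_of_ne_zero (map_apply_ne_zero _ Prod.snd h5)
    replace h1 := toReal_pos_of_ne_zero h1
    replace h2 := toReal_pos_of_ne_zero h2
    replace h3 := toReal_pos_of_ne_zero h3
    replace h4 := toReal_pos_of_ne_zero h4
    replace h5 := toReal_pos_of_ne_zero h5
    dsimp only at h1 h2 h3 h4 h5 h6
    have h7 := hq0 s.2.1 kf.2 kf.1
    have h8 := neg_log_decoder_mixture_le (ENNReal.toReal_nonneg (a := d s.2.1 kf.2 kf.1))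
      (hd1 _ _ _) hl1
    have h9 := Real.log_le_sub_one_of_pos (mul_pos (mul_pos (div_pos h6 h5)
      (div_pos (mul_pos h3 h2) (mul_pos h1 h4))) (half_pos h7))
    rw [Real.log_mul (by positivity) (by positivity), Real.log_mul (by positivity) (by positivity),
      Real.log_div h7.ne' two_ne_zero] at h9
    rw [← inv_div, Real.log_inv, ← inv_div (_ * _), Real.log_inv]
    linarith
  rw [errorProb_eq, expect_observedLaw, lawXZ, expect_map, lawXY, expect_map]
  simp only [expect_add, expect_sub, expect_neg, expect_const, mul_comm _ (Real.log l),
    expect_const_mul] at hpoint ⊢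
  rw [lawXZ, lawXY] at hpoint
  linarith

end Converse

/-! ### The performance of a code depends on pair laws only -/

section Performance

variable {X Y Z : Type*} [Fintype X] [Fintype Y] [Fintype Z] {n L : ℕ}

/-- Bob's output is discarded, so Y is integrated out and only the law of (X, Z) remains. -/
lemma keyWillieLaw_eq (P : PMF (X × Y × Z)) (c : Code X Y n L) :
    keyWillieLaw P c = observedLaw (pairPow (lawXZ P) n) c.enc := by
  rw [keyWillieLaw, jointLaw, observedLaw, pairPow, lawXZ, ← iid_map, PMF.map_comp, PMF.bind_map,
    PMF.map_bind]
  refine congrArg _ (funext fun s => ?_)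
  rw [PMF.map_bind]
  refine Eq.trans (congrArg _ (funext fun kf => ?_)) (PMF.bind_pure_comp _ _)
  rw [PMF.map_comp]
  exact PMF.map_const (c.dec (fun i => (s i).2.1) kf.2) (kf.1, (fun i => (s i).2.2), kf.2)

lemma keyLaw_eq (P : PMF (X × Y × Z)) (c : Code X Y n L) :
    keyLaw P c = (keyWillieLaw P c).map Prod.fst := by
  rw [keyWillieLaw, PMF.map_comp]
  rfl

lemma willieLaw_eq (P : PMF (X × Y × Z)) (c : Code X Y n L) :
    willieLaw P c = (keyWillieLaw P c).map Prod.snd := by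
  rw [keyWillieLaw, PMF.map_comp]
  rfl

lemma toReal_toOuterMeasure {α : Type*} [Fintype α] (p : PMF α) (s : Set α) [DecidablePred (· ∈ s)] :
    (p.toOuterMeasure s).toReal = expect p fun a => if a ∈ s then 1 else 0 := by
  rw [PMF.toOuterMeasure_apply_fintype, ENNReal.toReal_sum]
  · refine Finset.sum_congr rfl fun a _ => ?_
    by_cases h : a ∈ s <;> simp [h]
  · intro a _
    by_cases h : a ∈ s <;> simp [h, p.apply_ne_top]

lemma error_eq (P : PMF (X × Y × Z)) (c : Code X Y n L) :
    (jointLaw P c).toOuterMeasure {w | w.1 ≠ w.2.2.2} =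
      ENNReal.ofReal (errorProb (pairPow (lawXY P) n) c.enc c.dec) := by
  classical
  have h : (jointLaw P c).toOuterMeasure {w | w.1 ≠ w.2.2.2} ≠ ∞ := by
    rw [PMF.toOuterMeasure_apply_fintype]
    refine ENNReal.sum_ne_top.2 fun w _ => ne_top_of_le_ne_top (PMF.apply_ne_top (jointLaw P c) w) ?_
    exact Set.indicator_le_self _ _ w
  rw [← ENNReal.ofReal_toReal h, toReal_toOuterMeasure, errorProb, pairPow, lawXY, ← iid_map,
    PMF.map_comp, expect_map, jointLaw, expect_bind]
  simp only [expect_bind, expect_map, Function.comp, Set.mem_ofPred_eq]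
  congr!

end Performance

/-! ### Degraded sources -/

section Degraded

variable {X Y Z : Type*}

/-- The logarithmic ratio whose expectation is `I(X; Y) - I(X; Z)`. -/
def degradedRatio (P : PMF (X × Y × Z)) (s : X × Y × Z) : ℝ :=
  (lawXY P (s.1, s.2.1)).toReal * ((lawXZ P).map Prod.snd s.2.2).toReal /
    ((lawY P s.2.1).toReal * (lawXZ P (s.1, s.2.2)).toReal)

lemma degradedRatio_pos {P : PMF (X × Y × Z)} {s : X × Y × Z} (hs : P s ≠ 0) :
    0 < degradedRatio P s := by
  obtain ⟨h1, h2, h3, h4⟩ := law_apply_ne_zero P hs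
  exact div_pos (mul_pos (toReal_pos_of_ne_zero h1) (toReal_pos_of_ne_zero h4))
    (mul_pos (toReal_pos_of_ne_zero h3) (toReal_pos_of_ne_zero h2))

lemma eq_of_condProb_eq {α β : Type*} {p q : PMF (α × β)} (h1 : p.map Prod.fst = q.map Prod.fst)
    (h2 : ∀ a b, condProb p b a = condProb q b a) : p = q := by
  ext ⟨a, b⟩
  have h := h2 a b
  rw [condProb, condProb, ← h1] at h
  by_cases ha : p.map Prod.fst a = 0
  · have hp : p (a, b) = 0 := by
      by_contra hp
      exact map_apply_ne_zero p Prod.fst hp ha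
    have hq : q (a, b) = 0 := by
      by_contra hq
      exact map_apply_ne_zero q Prod.fst hq (h1 ▸ ha)
    rw [hp, hq]
  · rw [← ENNReal.div_mul_cancel (a := p.map Prod.fst a) (b := p (a, b)) ha (PMF.apply_ne_top _ _), h,
      ENNReal.div_mul_cancel ha (PMF.apply_ne_top _ _)]

lemma StochasticallyDegradedVia.lawXY_eq {P' P : PMF (X × Y × Z)}
    (h : StochasticallyDegradedVia P' P) : lawXY P' = lawXY P := by
  refine eq_of_condProb_eq ?_ h.condY_eq
  have h1 := h.lawX_eq
  rw [lawX, lawX] at h1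
  rw [lawXY, lawXY, PMF.map_comp, PMF.map_comp]
  exact h1

lemma StochasticallyDegradedVia.lawXZ_eq {P' P : PMF (X × Y × Z)}
    (h : StochasticallyDegradedVia P' P) : lawXZ P' = lawXZ P := by
  refine eq_of_condProb_eq ?_ h.condZ_eq
  have h1 := h.lawX_eq
  rw [lawX, lawX] at h1
  rw [lawXZ, lawXZ, PMF.map_comp, PMF.map_comp]
  exact h1

end Degraded

/-! ### Powers of a source -/

section SourcePower

variable {X Y Z : Type*} [Fintype X] [Fintype Y] [Fintype Z]

/-- The law of the triple of sequences of `n` i.i.d. triples. -/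
def sourcePow (P : PMF (X × Y × Z)) (n : ℕ) :
    PMF ((Fin n → X) × (Fin n → Y) × (Fin n → Z)) :=
  (iid P n).map fun s => (fun i => (s i).1, fun i => (s i).2.1, fun i => (s i).2.2)

lemma lawXY_sourcePow (P : PMF (X × Y × Z)) (n : ℕ) :
    lawXY (sourcePow P n) = pairPow (lawXY P) n := by
  rw [lawXY, lawXY, sourcePow, pairPow, ← iid_map, PMF.map_comp, PMF.map_comp]
  rfl

lemma lawXZ_sourcePow (P : PMF (X × Y × Z)) (n : ℕ) :
    lawXZ (sourcePow P n) = pairPow (lawXZ P) n := by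
  rw [lawXZ, lawXZ, sourcePow, pairPow, ← iid_map, PMF.map_comp, PMF.map_comp]
  rfl

lemma lawYZ_sourcePow (P : PMF (X × Y × Z)) (n : ℕ) :
    lawYZ (sourcePow P n) = pairPow (lawYZ P) n := by
  rw [lawYZ, lawYZ, sourcePow, pairPow, ← iid_map, PMF.map_comp, PMF.map_comp]
  rfl

lemma lawY_sourcePow (P : PMF (X × Y × Z)) (n : ℕ) :
    lawY (sourcePow P n) = iid (lawY P) n := by
  rw [lawY, lawY, sourcePow, ← iid_map, PMF.map_comp]
  rfl

lemma toReal_sourcePow_apply (P : PMF (X × Y × Z)) (n : ℕ) (x : Fin n → X) (y : Fin n → Y)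
    (z : Fin n → Z) : (sourcePow P n (x, y, z)).toReal = ∏ i, (P (x i, y i, z i)).toReal := by
  classical
  rw [sourcePow, toReal_map_apply, expect, Finset.sum_eq_single fun i => (x i, y i, z i)]
  · simp [toReal_iid_apply]
  · intro t _ ht
    rw [if_neg, mul_zero]
    intro h
    simp only [Prod.mk.injEq] at h
    obtain ⟨rfl, rfl, rfl⟩ := h
    exact ht rfl
  · simp

/-- This lets the one-shot equivocation bound be applied to a whole block at once. -/
lemma PhysicallyDegraded.sourcePow {P : PMF (X × Y × Z)} (h : PhysicallyDegraded P) (n : ℕ) :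
    PhysicallyDegraded (sourcePow P n) := by
  intro x y z
  rw [← ENNReal.toReal_eq_toReal_iff'
    (ENNReal.mul_ne_top (PMF.apply_ne_top _ _) (PMF.apply_ne_top _ _))
    (ENNReal.mul_ne_top (PMF.apply_ne_top _ _) (PMF.apply_ne_top _ _)),
    ENNReal.toReal_mul, ENNReal.toReal_mul, lawXY_sourcePow, lawYZ_sourcePow, lawY_sourcePow,
    toReal_sourcePow_apply, toReal_pairPow_apply, toReal_pairPow_apply, toReal_iid_apply,
    ← Finset.prod_mul_distrib, ← Finset.prod_mul_distrib]
  refine Finset.prod_congr rfl fun i _ => ?_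
  rw [← ENNReal.toReal_mul, ← ENNReal.toReal_mul, h]

lemma expect_log_degradedRatio (P : PMF (X × Y × Z)) :
    expect P (fun s => Real.log (degradedRatio P s)) =
      (mutualInfo (lawXY P) - mutualInfo (lawXZ P)) * Real.log 2 := by
  rw [mutualInfo_eq, mutualInfo_eq, sub_mul, div_mul_cancel₀ _ (Real.log_pos one_lt_two).ne',
    div_mul_cancel₀ _ (Real.log_pos one_lt_two).ne']
  conv_rhs => rw [lawXY, expect_map, ← lawXY, lawXZ, expect_map, ← lawXZ]
  rw [← expect_sub]
  refine expect_congr fun s hs => ?_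
  obtain ⟨h1, h2, h3, h4⟩ := law_apply_ne_zero P hs
  have h5 : lawX P s.1 ≠ 0 := map_apply_ne_zero P (fun s => s.1) hs
  replace h1 := toReal_pos_of_ne_zero h1
  replace h2 := toReal_pos_of_ne_zero h2
  replace h3 := toReal_pos_of_ne_zero h3
  replace h4 := toReal_pos_of_ne_zero h4
  replace h5 := toReal_pos_of_ne_zero h5
  have e1 : (lawXY P).map Prod.fst = lawX P := by rw [lawXY, PMF.map_comp]; rfl
  have e2 : (lawXY P).map Prod.snd = lawY P := by rw [lawXY, PMF.map_comp]; rfl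
  have e3 : (lawXZ P).map Prod.fst = lawX P := by rw [lawXZ, PMF.map_comp]; rfl
  dsimp only
  rw [e1, e2, e3, degradedRatio, ← Real.log_div (by positivity) (by positivity)]
  congr 1
  field_simp

lemma expect_iid_sum {α : Type*} [Fintype α] (p : PMF α) (n : ℕ) (φ : α → ℝ) :
    expect (iid p n) (fun s => ∑ i, φ (s i)) = n * expect p φ := by
  rw [expect_sum]
  simp [expect_iid_eval p n _ φ]

lemma iid_apply_ne_zero {α : Type*} [Fintype α] {p : PMF α} {n : ℕ} {s : Fin n → α} :
    iid p n s ≠ 0 ↔ ∀ i, p (s i) ≠ 0 := by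
  rw [iid, PMF.ofFintype_apply]
  simp [Finset.prod_eq_zero_iff]

lemma expect_log_degradedRatio_sourcePow (P : PMF (X × Y × Z)) (n : ℕ) :
    expect (sourcePow P n) (fun s => Real.log (degradedRatio (sourcePow P n) s)) =
      n * expect P (fun s => Real.log (degradedRatio P s)) := by
  rw [sourcePow, expect_map, ← expect_iid_sum, ← sourcePow]
  refine expect_congr fun s hs => ?_
  rw [← Real.log_prod fun i _ => (degradedRatio_pos (iid_apply_ne_zero.1 hs i)).ne']
  congr 1
  simp only [degradedRatio]
  rw [lawXY_sourcePow, lawXZ_sourcePow, lawY_sourcePow, pairPow_map_snd, toReal_iid_apply,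
    toReal_iid_apply, toReal_pairPow_apply, toReal_pairPow_apply, ← Finset.prod_mul_distrib,
    ← Finset.prod_mul_distrib, ← Finset.prod_div_distrib]

end SourcePower

/-! ### Converse -/

section Converse

variable {X Y Z : Type*} [Fintype X] [Fintype Y] [Fintype Z]

/-- The identity H(K) = I(K; W) + H(K | W). -/
lemma entropy_map_fst {α β : Type*} [Fintype α] [Fintype β] (p : PMF (α × β)) :
    entropy (p.map Prod.fst) * Real.log 2 =
      relEntropy p (prodLaw (p.map Prod.fst) (p.map Prod.snd)) -
        expect p fun w => Real.log ((p w).toReal / (p.map Prod.snd w.2).toReal) := by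
  have h1 : entropy (p.map Prod.fst) * Real.log 2 =
      expect p fun w => -Real.log (p.map Prod.fst w.1).toReal := by
    rw [← expect_map p Prod.fst fun a => -Real.log (p.map Prod.fst a).toReal, entropy,
      ← Finset.sum_div, div_mul_cancel₀ _ (Real.log_pos one_lt_two).ne']
    refine Finset.sum_congr rfl fun a _ => ?_
    rw [Real.negMulLog]
    ring
  rw [h1, relEntropy, ← expect_sub]
  refine expect_congr fun s hs => ?_
  have h2 := toReal_pos_of_ne_zero (map_apply_ne_zero p Prod.fst hs)
  have h3 := toReal_pos_of_ne_zero (map_apply_ne_zero p Prod.snd hs)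
  have h4 := toReal_pos_of_ne_zero hs
  obtain ⟨a, b⟩ := s
  rw [prodLaw_apply, ENNReal.toReal_mul, ← Real.log_div (by positivity) (by positivity),
    ← Real.log_inv]
  congr 1
  dsimp only at *
  field_simp

/-- Uniformity and secrecy each cost ε, Fano's inequality costs one bit, and its error term moves to
the left side as ε log L. -/
lemma Meets.log_card_le [AddCommGroup X] {P' P : PMF (X × Y × Z)}
    (h : StochasticallyDegradedVia P' P) {n L : ℕ} {c : Code X Y n L} {ε : ℝ} (hε : 0 ≤ ε)
    (hc : Meets P' c ε) :
    (1 - ε) * Real.log L ≤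
      (n * (mutualInfo (lawXY P) - mutualInfo (lawXZ P)) + 1 + 2 * ε) * Real.log 2 := by
  have hl2 : 0 < Real.log 2 := Real.log_pos one_lt_two
  have herr := hc.error
  -- Only pair laws occur, so the bounds pass to the physically degraded source.
  rw [error_eq, h.lawXY_eq, ENNReal.ofReal_le_ofReal_iff hε, ← lawXY_sourcePow] at herr
  have hunif := hc.uniformity
  -- The converse needs only the non-confusion half of effective secrecy.
  have hsec := le_trans le_self_add hc.effectiveSecrecy
  rw [keyLaw_eq, keyWillieLaw_eq, h.lawXZ_eq] at hunif
  rw [willieLaw_eq, keyLaw_eq, keyWillieLaw_eq, h.lawXZ_eq, divergence_eq_ofReal,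
    ENNReal.ofReal_le_ofReal_iff hε, div_le_iff₀ hl2] at hsec
  swap
  · rintro ⟨a, b⟩ hs
    rw [prodLaw_apply]
    exact mul_ne_zero (map_apply_ne_zero _ Prod.fst hs) (map_apply_ne_zero _ Prod.snd hs)
  rw [← lawXZ_sourcePow] at hunif hsec
  have hent := entropy_map_fst (observedLaw (lawXZ (sourcePow P n)) c.enc)
  have hequiv := equivocation_le (h.physicallyDegraded.sourcePow n) c.enc c.dec
  have hsum := expect_log_degradedRatio_sourcePow P n
  rw [expect_log_degradedRatio P] at hsum
  simp only [degradedRatio] at hsum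
  rw [hsum, Fintype.card_fin] at hequiv
  have hlog : Real.logb 2 L * Real.log 2 = Real.log L := by
    rw [Real.logb, div_mul_cancel₀ _ hl2.ne']
  have h1 := mul_le_mul_of_nonneg_right hunif hl2.le
  have h2 := mul_le_mul_of_nonneg_right herr (Real.log_natCast_nonneg L)
  rw [sub_mul, hlog, hent] at h1
  linarith

theorem Achievable.le [AddCommGroup X] {P' P : PMF (X × Y × Z)}
    (h : StochasticallyDegradedVia P' P) {A : ∀ n L : ℕ, Set (Code X Y n L)} {R : ℝ} (hR : 0 ≤ R)
    (hA : Achievable A P' R) : R ≤ mutualInfo (lawXY P) - mutualInfo (lawXZ P) := by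
  set C := mutualInfo (lawXY P) - mutualInfo (lawXZ P) with hC
  by_contra! hlt
  -- With this ε, the inequality (1 - ε) n R ≤ n C + 1 + 2ε yields n (R - C) ≤ n (R - C) / 2 + 3,
  -- which fails once n (R - C) > 6. The R + 1 keeps the denominator positive at R = 0.
  set ε := min 1 ((R - C) / (2 * (R + 1))) with hεdef
  have hε : 0 < ε := lt_min one_pos (div_pos (by linarith) (by linarith))
  have hε1 : ε ≤ 1 := min_le_left _ _
  have hεR : ε * (2 * (R + 1)) ≤ R - C :=
    (le_div_iff₀ (by linarith)).1 (min_le_right _ _)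
  obtain ⟨n₀, hn₀⟩ := hA ε hε
  obtain ⟨n₁, hn₁⟩ := exists_nat_gt (6 / (R - C))
  obtain ⟨c, -, hc⟩ := hn₀ (max n₀ n₁) (le_max_left _ _)
  have h1 := hc.log_card_le h hε.le
  rw [← hC] at h1
  have hn : (6 : ℝ) < (max n₀ n₁ : ℕ) * (R - C) := by
    rw [div_lt_iff₀ (by linarith)] at hn₁
    refine hn₁.trans_le (mul_le_mul_of_nonneg_right ?_ (by linarith))
    exact_mod_cast le_max_right _ _
  generalize max n₀ n₁ = n at *
  have h2 : (n : ℝ) * R * Real.log 2 ≤ Real.log ⌈(2 : ℝ) ^ ((n : ℝ) * R)⌉₊ := by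
    rw [← Real.log_rpow two_pos]
    exact Real.log_le_log (Real.rpow_pos_of_pos two_pos _) (Nat.le_ceil _)
  have h3 := (mul_le_mul_of_nonneg_left h2 (by linarith : 0 ≤ 1 - ε)).trans h1
  have h4 : (1 - ε) * (n * R) ≤ n * C + 1 + 2 * ε := by
    refine le_of_mul_le_mul_right ?_ (Real.log_pos one_lt_two)
    linarith
  have h5 : (n : ℝ) * (ε * (2 * R)) ≤ n * (R - C) :=
    mul_le_mul_of_nonneg_left (by linarith) (Nat.cast_nonneg n)
  linarith

end Converse

/-! ### Random codebooks in a finite abelian group -/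

section Analysis

/-- Logarithms are taken in (1 + t) ^ s ≤ 1 + t ^ s. The point is to trade log for a fractional
moment, which factors over blocks. -/
lemma log_one_add_le_rpow_div {t s : ℝ} (ht : 0 ≤ t) (hs : 0 < s) (hs1 : s ≤ 1) :
    Real.log (1 + t) ≤ t ^ s / s := by
  rw [le_div_iff₀ hs, mul_comm, ← Real.log_rpow (by linarith)]
  have h1 := Real.rpow_add_le_add_rpow zero_le_one ht hs.le hs1
  rw [Real.one_rpow] at h1
  have h2 := Real.log_le_log (Real.rpow_pos_of_pos (by linarith) s) h1
  have h3 := Real.log_le_sub_one_of_pos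
    (by have := Real.rpow_nonneg ht s; linarith : 0 < 1 + t ^ s)
  linarith

/-- If `E log φ < 0`, then some fractional moment of `φ` is less than one. -/
lemma exists_expect_rpow_lt_one {α : Type*} [Fintype α] {p : PMF α} {φ : α → ℝ}
    (hφ : ∀ a, p a ≠ 0 → 0 < φ a) (h : expect p (fun a => Real.log (φ a)) < 0) :
    ∃ s : ℝ, 0 < s ∧ s ≤ 1 ∧ expect p (fun a => φ a ^ s) < 1 := by
  -- The moment equals 1 at s = 0 and has negative derivative E log φ there, so it drops below 1
  -- just to the right.
  have hd : HasDerivAt (fun s : ℝ => expect p fun a => φ a ^ s)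
      (expect p fun a => Real.log (φ a)) 0 := by
    unfold expect
    refine HasDerivAt.fun_sum fun a _ => ?_
    by_cases ha : p a = 0
    · simpa [ha] using hasDerivAt_const (0 : ℝ) (0 : ℝ)
    · have h1 := (Real.hasStrictDerivAt_const_rpow (hφ a ha) 0).hasDerivAt.const_mul (p a).toReal
      simpa using h1
  have hslope := (hasDerivAt_iff_tendsto_slope.1 hd).eventually_lt_const h
  have hright : ∀ᶠ s : ℝ in nhdsWithin 0 (Set.Ioi 0),
      slope (fun s : ℝ => expect p fun a => φ a ^ s) 0 s < 0 :=
    hslope.filter_mono (nhdsWithin_mono _ fun s hs => ne_of_gt hs)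
  obtain ⟨s, hs, hs0, hs1⟩ := (hright.and (Ioc_mem_nhdsGT one_pos)).exists
  refine ⟨s, hs0, hs1, ?_⟩
  rw [slope_def_field, sub_zero, div_lt_iff₀ hs0, zero_mul] at hs
  simp only [Real.rpow_zero, expect_const] at hs
  linarith

end Analysis

section Ratio

variable {G B : Type*} [Fintype G]

/-- The likelihood ratio of the channel `u ↦ (Y, u + X)` with respect to uniform inputs, as a
function of the noise. -/
def ratio (p : PMF (G × B)) (s : G × B) : ℝ :=
  Fintype.card G * (p s).toReal / (p.map Prod.snd s.2).toReal

lemma ratio_nonneg (p : PMF (G × B)) (s : G × B) : 0 ≤ ratio p s := by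
  unfold ratio
  positivity

lemma ratio_pos {p : PMF (G × B)} {s : G × B} (hs : p s ≠ 0) : 0 < ratio p s :=
  div_pos (mul_pos (Nat.cast_pos.2 (Fintype.card_pos_iff.2 ⟨s.1⟩)) (toReal_pos_of_ne_zero hs))
    (toReal_pos_of_ne_zero (map_apply_ne_zero p Prod.snd hs))

end Ratio

/-! ### One-shot bounds for a random codebook -/

section Codebook

variable {G B D I K J : Type*} [Fintype G] [AddCommGroup G] [Fintype B] [Fintype D] [Fintype I]
  [Fintype K] [Fintype J]

/-- In a uniform random codebook the difference of two codewords is uniform. -/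
lemma expect_codebook_sub [DecidableEq I] {i j : I} (hij : i ≠ j) (x : G) (φ : G → ℝ) :
    expect (PMF.uniformOfFintype (I → G)) (fun u => φ (u i + x - u j)) =
      expect (PMF.uniformOfFintype G) φ := by
  -- Translating the codeword i by v preserves the uniform law of codebooks and shifts the
  -- difference by v; averaging over v makes it uniform.
  have h1 : ∀ v : G, expect (PMF.uniformOfFintype (I → G)) (fun u => φ (u i + x - u j)) =
      expect (PMF.uniformOfFintype (I → G)) fun u => φ (u i + x - u j + v) := by
    intro v
    rw [expect_uniform, expect_uniform]
    congr 1
    rw [← Equiv.sum_comp (Equiv.addRight (Pi.single i v))]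
    refine Finset.sum_congr rfl fun u _ => ?_
    simp only [Equiv.coe_addRight, Pi.add_apply, Pi.single_eq_same, Pi.single_eq_of_ne hij.symm,
      add_zero]
    congr 1
    abel
  rw [← expect_const (PMF.uniformOfFintype G)
    (expect (PMF.uniformOfFintype (I → G)) fun u => φ (u i + x - u j))]
  conv_lhs => enter [2, v]; rw [h1 v]
  rw [expect_comm, ← expect_const (PMF.uniformOfFintype (I → G))
    (expect (PMF.uniformOfFintype G) φ)]
  congr 1; funext u
  rw [expect_uniform, expect_uniform]
  congr 1
  exact Equiv.sum_comp (Equiv.addLeft (u i + x - u j)) φ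

/-- This is the mean contribution of a codeword that was not sent, both in soft covering and in the
union bound. -/
lemma expect_ratio {p : PMF (G × B)} {y : B} (hy : p.map Prod.snd y ≠ 0) :
    expect (PMF.uniformOfFintype G) (fun v => ratio p (v, y)) = 1 := by
  have h1 := (toReal_pos_of_ne_zero hy).ne'
  have h2 : (Fintype.card G : ℝ) ≠ 0 := Nat.cast_ne_zero.2 Fintype.card_ne_zero
  simp only [expect_uniform, ratio, ← Finset.sum_div, ← Finset.mul_sum]
  rw [← toReal_map_snd_apply]
  field_simp

lemma expect_log_ratio_nonneg (p : PMF (G × B)) :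
    0 ≤ expect p fun s => Real.log (ratio p s) := by
  have h : expect p (fun s => Real.log (ratio p s)⁻¹) ≤ 0 := by
    refine expect_log_nonpos (fun s hs => inv_pos.2 (ratio_pos hs)) ?_
    have h2 : (Fintype.card G : ℝ) ≠ 0 := Nat.cast_ne_zero.2 Fintype.card_ne_zero
    calc _ ≤ ∑ s : G × B, (p.map Prod.snd s.2).toReal / Fintype.card G := by
          refine Finset.sum_le_sum fun s _ => ?_
          by_cases hs : p s = 0
          · simp only [hs, ENNReal.toReal_zero, zero_mul]
            positivity
          · have := (toReal_pos_of_ne_zero hs).ne'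
            simp only [ratio]
            field_simp
            exact le_rfl
      _ = 1 := by
          rw [Fintype.sum_prod_type]
          simp only [← Finset.sum_div, sum_toReal_eq_one]
          simp [h2]
  simp only [Real.log_inv, expect_neg] at h
  linarith

/-- The encoder that draws an entry of the codebook `u` and hides it behind the source. -/
def wiretapEnc [Nonempty K] [Nonempty J] (u : K × J → G) (x : G) : PMF (K × G) :=
  (PMF.uniformOfFintype (K × J)).map fun i => (i.1, u i + x)

/-- The law of `(Z, V + X)` for `V` uniform and independent of `(X, Z)`. -/
def maskedLaw (p : PMF (G × D)) : PMF (D × G) :=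
  p.bind fun s => (PMF.uniformOfFintype G).map fun v => (s.2, v + s.1)

/-- For each source value exactly one mask produces f, so the masked symbol is uniform and
independent of Z. -/
lemma toReal_maskedLaw_apply (p : PMF (G × D)) (z : D) (f : G) :
    (maskedLaw p (z, f)).toReal = (p.map Prod.snd z).toReal / Fintype.card G := by
  classical
  rw [toReal_apply_eq_expect, maskedLaw, expect_bind, toReal_map_apply, div_eq_inv_mul,
    ← expect_const_mul]
  congr 1; funext s
  rw [expect_map, expect_uniform]
  congr 1
  rw [Finset.sum_eq_single (f - s.1)]
  · simp
  · intro v _ hv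
    rw [if_neg]
    exact fun h => hv (eq_sub_of_add_eq (Prod.ext_iff.1 h).2)
  · simp

lemma maskedLaw_apply_ne_zero {p : PMF (G × D)} {K : Type*} {e : G → PMF (K × G)} {b : D × G}
    (h : (observedLaw p e).map Prod.snd b ≠ 0) : maskedLaw p b ≠ 0 := by
  rw [← PMF.mem_support_iff, PMF.mem_support_map_iff] at h
  obtain ⟨w, hw, rfl⟩ := h
  rw [observedLaw, PMF.mem_support_bind_iff] at hw
  obtain ⟨s, hs, hw⟩ := hw
  rw [PMF.mem_support_map_iff] at hw
  obtain ⟨kf, -, rfl⟩ := hw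
  refine ne_zero_of_toReal_ne_zero ?_
  rw [toReal_maskedLaw_apply]
  exact (div_pos (toReal_pos_of_ne_zero (map_apply_ne_zero p Prod.snd hs))
    (Nat.cast_pos.2 Fintype.card_pos)).ne'

lemma errorProb_nonneg {A F : Type*} [Fintype A] [Fintype F] (p : PMF (A × B))
    (e : A → PMF (K × F)) (d : B → F → PMF K) : 0 ≤ errorProb p e d := by
  refine expect_nonneg fun s _ => expect_nonneg fun kf _ => expect_nonneg fun k' _ => ?_
  split_ifs <;> norm_num

variable [Nonempty K] [Nonempty J]

/-- The divergence, in nats, of the law of `(K, Z, F)` from a uniform key that is independent of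
the masked source. -/
def secrecyLoss (p : PMF (G × D)) (u : K × J → G) : ℝ :=
  expect p fun s => expect (PMF.uniformOfFintype (K × J)) fun i =>
    Real.log ((Fintype.card J : ℝ)⁻¹ * ∑ j, ratio p (u i + s.1 - u (i.1, j), s.2))

lemma toReal_observedLaw_wiretapEnc_apply (p : PMF (G × D)) (u : K × J → G) (k : K) (z : D)
    (f : G) : (observedLaw p (wiretapEnc u) (k, z, f)).toReal =
      (Fintype.card K : ℝ)⁻¹ * ((Fintype.card J : ℝ)⁻¹ * ∑ j, (p (f - u (k, j), z)).toReal) := by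
  classical
  rw [toReal_observedLaw_apply]
  simp only [wiretapEnc, toReal_map_apply, expect_uniform, Finset.mul_sum]
  rw [Finset.sum_comm, Fintype.sum_prod_type, Finset.sum_eq_single k]
  · refine Finset.sum_congr rfl fun j _ => ?_
    rw [Finset.sum_eq_single (f - u (k, j))]
    · simp
      ring
    · intro x _ hx
      rw [if_neg, mul_zero, mul_zero]
      exact fun h => hx (eq_sub_of_add_eq' (Prod.ext_iff.1 h).2)
    · simp
  · intro k' _ hk
    simp [hk]
  · simp

lemma observedLaw_wiretapEnc_map_fst (p : PMF (G × D)) (u : K × J → G) :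
    (observedLaw p (wiretapEnc u)).map Prod.fst = PMF.uniformOfFintype K := by
  classical
  ext k
  rw [← ENNReal.toReal_eq_toReal_iff' (PMF.apply_ne_top _ _) (PMF.apply_ne_top _ _),
    toReal_map_apply, expect_observedLaw, ← expect_const p
      (PMF.uniformOfFintype K k).toReal]
  congr 1; funext s
  rw [wiretapEnc, expect_map, expect_uniform, Fintype.sum_prod_type, Finset.sum_eq_single k]
  · simp
    field_simp
  · intro k' _ hk
    simp [hk]
  · simp

/-- The two divergences merge by the chain rule into one divergence from a product. Evaluated at f =
u i + x, its log-ratio is the average over j of the channel likelihood ratios of the codewords that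
share the key of i. -/
lemma secrecyLoss_eq (p : PMF (G × D)) (u : K × J → G) :
    secrecyLoss p u =
      relEntropy (observedLaw p (wiretapEnc u))
          (prodLaw ((observedLaw p (wiretapEnc u)).map Prod.fst)
            ((observedLaw p (wiretapEnc u)).map Prod.snd)) +
        relEntropy ((observedLaw p (wiretapEnc u)).map Prod.snd) (maskedLaw p) := by
  have hK : (Fintype.card K : ℝ) ≠ 0 := Nat.cast_ne_zero.2 Fintype.card_ne_zero
  rw [relEntropy_prodLaw_add fun b => maskedLaw_apply_ne_zero, expect_observedLaw, secrecyLoss]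
  refine expect_congr fun s hs => ?_
  rw [wiretapEnc, expect_map]
  congr 1; funext i
  rw [observedLaw_wiretapEnc_map_fst, toReal_observedLaw_wiretapEnc_apply, toReal_maskedLaw_apply]
  have h1 := (toReal_pos_of_ne_zero (map_apply_ne_zero p Prod.snd hs)).ne'
  have hG : (Fintype.card G : ℝ) ≠ 0 := Nat.cast_ne_zero.2 Fintype.card_ne_zero
  congr 1
  simp only [ratio, ← Finset.sum_div, ← Finset.mul_sum, PMF.uniformOfFintype_apply,
    ENNReal.toReal_inv, ENNReal.toReal_natCast]
  field_simp

lemma secrecyLoss_nonneg (p : PMF (G × D)) (u : K × J → G) : 0 ≤ secrecyLoss p u := by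
  rw [secrecyLoss_eq]
  refine add_nonneg (relEntropy_nonneg ?_) (relEntropy_nonneg fun b => maskedLaw_apply_ne_zero)
  rintro ⟨a, b⟩ hs
  rw [prodLaw_apply]
  exact mul_ne_zero (map_apply_ne_zero _ Prod.fst hs) (map_apply_ne_zero _ Prod.snd hs)

/-- Soft covering: the secrecy loss of a random codebook. -/
lemma expect_secrecyLoss_le [DecidableEq K] [DecidableEq J] (p : PMF (G × D)) {t : ℝ}
    (ht : 0 < t) (ht1 : t ≤ 1) :
    expect (PMF.uniformOfFintype (K × J → G)) (secrecyLoss p) ≤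
      expect p (fun s => (ratio p s / Fintype.card J) ^ t) / t := by
  classical
  unfold secrecyLoss
  have hJ : (0 : ℝ) < Fintype.card J := Nat.cast_pos.2 Fintype.card_pos
  rw [expect_comm, div_eq_inv_mul, ← expect_const_mul]
  refine expect_mono fun s hs => ?_
  rw [expect_comm, ← expect_const (PMF.uniformOfFintype (K × J)) (t⁻¹ * _)]
  refine expect_mono fun i _ => ?_
  have ha := ratio_pos hs
  -- Mean of the inner average is at most c: the sent codeword contributes its own ratio over |J|,
  -- every other one contributes 1 / |J|.
  set c := 1 + ratio p s / Fintype.card J with hc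
  have hc0 : 0 < c := by positivity
  have hE : expect (PMF.uniformOfFintype (K × J → G)) (fun u => (Fintype.card J : ℝ)⁻¹ *
      ∑ j, ratio p (u i + s.1 - u (i.1, j), s.2)) ≤ c := by
    rw [expect_const_mul, expect_sum]
    have h1 : ∀ j, expect (PMF.uniformOfFintype (K × J → G))
        (fun u => ratio p (u i + s.1 - u (i.1, j), s.2)) ≤
          1 + if j = i.2 then ratio p s else 0 := by
      intro j
      by_cases hj : j = i.2
      · subst hj
        simp [expect_const]
      · rw [if_neg hj, expect_codebook_sub (fun h => hj (by rw [h])) s.1 fun v => ratio p (v, s.2),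
          expect_ratio (map_apply_ne_zero p Prod.snd hs), add_zero]
    calc _ ≤ (Fintype.card J : ℝ)⁻¹ * ∑ j, (1 + if j = i.2 then ratio p s else 0) :=
          mul_le_mul_of_nonneg_left (Finset.sum_le_sum fun j _ => h1 j) (by positivity)
      _ = c := by
          rw [Finset.sum_add_distrib, Finset.sum_ite_eq' Finset.univ i.2]
          simp only [Finset.sum_const, Finset.card_univ, nsmul_eq_mul, mul_one, Finset.mem_univ,
            if_true]
          rw [hc]
          field_simp
  -- Jensen's inequality for log, through its tangent line at c.
  calc _ ≤ expect (PMF.uniformOfFintype (K × J → G)) (fun u => Real.log c + (c⁻¹ *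
          ((Fintype.card J : ℝ)⁻¹ * ∑ j, ratio p (u i + s.1 - u (i.1, j), s.2)) - 1)) := by
        refine expect_mono fun u _ => ?_
        set b := (Fintype.card J : ℝ)⁻¹ * ∑ j, ratio p (u i + s.1 - u (i.1, j), s.2) with hb
        have hb0 : 0 < b := by
          refine mul_pos (by positivity) (Finset.sum_pos' (fun j _ => ratio_nonneg _ _)
            ⟨i.2, Finset.mem_univ _, ?_⟩)
          simpa using ha
        have h1 := Real.log_le_sub_one_of_pos (mul_pos (inv_pos.2 hc0) hb0)
        rw [Real.log_mul (by positivity) hb0.ne', Real.log_inv] at h1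
        linarith
    _ ≤ Real.log c := by
        rw [expect_add, expect_sub, expect_const, expect_const, expect_const_mul]
        have h1 := mul_le_mul_of_nonneg_left hE (inv_pos.2 hc0).le
        rw [inv_mul_cancel₀ hc0.ne'] at h1
        linarith
    _ ≤ _ := by
        rw [← div_eq_inv_mul]
        exact log_one_add_le_rpow_div (by positivity) ht ht1

open Classical in
/-- The threshold decoder. -/
def thresholdDec (p : PMF (G × B)) (T : ℝ) (u : K × J → G) (y : B) (f : G) : K :=
  if h : ∃ i, T < ratio p (f - u i, y) then h.choose.1 else Classical.arbitrary K

/-- The error probability of the threshold decoder for a random codebook. -/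
lemma expect_errorProb_le [DecidableEq K] [DecidableEq J] (p : PMF (G × B)) {T s : ℝ}
    (hT : 0 < T) (hs : 0 < s) :
    expect (PMF.uniformOfFintype (K × J → G)) (fun u => errorProb p (wiretapEnc u)
        fun y f => PMF.pure (thresholdDec p T u y f)) ≤
      expect p (fun v => (T / ratio p v) ^ s) + Fintype.card K * Fintype.card J / T := by
  classical
  simp only [errorProb, wiretapEnc, expect_map, expect_pure]
  rw [expect_comm, ← expect_const p (_ / T), ← expect_add]
  refine expect_mono fun v hv => ?_
  rw [expect_comm, ← expect_const (PMF.uniformOfFintype (K × J)) (_ + _ / T)]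
  refine expect_mono fun i _ => ?_
  have hv0 := ratio_pos hv
  calc _ ≤ expect (PMF.uniformOfFintype (K × J → G)) (fun u => (T / ratio p v) ^ s +
          ∑ j, if j = i then 0 else T⁻¹ * ratio p (u i + v.1 - u j, v.2)) := by
        refine expect_mono fun u _ => ?_
        have h0 : ∀ j, 0 ≤ if j = i then 0 else T⁻¹ * ratio p (u i + v.1 - u j, v.2) := by
          intro j
          split_ifs
          · exact le_rfl
          · exact mul_nonneg (inv_pos.2 hT).le (ratio_nonneg _ _)
        have h1 := Finset.sum_nonneg fun j (_ : j ∈ Finset.univ) => h0 j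
        have h2 : 0 ≤ (T / ratio p v) ^ s := by positivity
        split_ifs with herr
        swap
        · linarith
        -- An error has two causes: the sent codeword misses the threshold, a Markov-type event, or
        -- the decoder picks another codeword above it, a union bound.
        by_cases hle : ratio p v ≤ T
        · have h3 : 1 ≤ (T / ratio p v) ^ s :=
            Real.one_le_rpow ((one_le_div hv0).2 hle) hs.le
          linarith
        · have hex : ∃ j, T < ratio p (u i + v.1 - u j, v.2) := ⟨i, by simpa using hle⟩
          rw [thresholdDec, dif_pos hex] at herr
          have h3 := Finset.single_le_sum (fun j _ => h0 j) (Finset.mem_univ hex.choose)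
          rw [if_neg (fun h => herr (by rw [h]))] at h3
          have h4 := (one_le_div hT).2 hex.choose_spec.le
          rw [div_eq_inv_mul] at h4
          linarith
    _ ≤ _ := by
        rw [expect_add, expect_const, expect_sum]
        refine add_le_add_right ?_ _
        calc _ ≤ ∑ j : K × J, T⁻¹ := by
              refine Finset.sum_le_sum fun j _ => ?_
              by_cases hj : j = i
              · simpa [hj, expect_const] using hT.le
              · simp only [if_neg hj]
                rw [expect_const_mul, expect_codebook_sub (Ne.symm hj) v.1
                  fun x => ratio p (x, v.2), expect_ratio (map_apply_ne_zero p Prod.snd hv), mul_one]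
          _ = _ := by
              simp [Fintype.card_prod, div_eq_mul_inv]

/-- Random coding: some codebook is both reliable and stealthily secret. -/
theorem exists_codebook (K J : Type*) [Fintype K] [Fintype J] [Nonempty K] [Nonempty J]
    (p : PMF (G × B)) (q : PMF (G × D)) {T s t : ℝ} (hT : 0 < T)
    (hs : 0 < s) (ht : 0 < t) (ht1 : t ≤ 1) :
    ∃ (u : K × J → G) (g : B → G → K),
      errorProb p (wiretapEnc u) (fun y f => PMF.pure (g y f)) + secrecyLoss q u ≤
        expect p (fun v => (T / ratio p v) ^ s) + Fintype.card K * Fintype.card J / T +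
          expect q (fun v => (ratio q v / Fintype.card J) ^ t) / t := by
  classical
  -- Bounding the sum of the two nonnegative costs yields one codebook good for both.
  have h := add_le_add (expect_errorProb_le (K := K) (J := J) p hT hs)
    (expect_secrecyLoss_le (K := K) (J := J) q ht ht1)
  rw [← expect_add] at h
  obtain ⟨u, hu⟩ := exists_le_of_expect_le h
  exact ⟨u, thresholdDec p T u, hu⟩

end Codebook

/-! ### Achievability by conceptual wiretap codes -/

section WiretapCode

variable {X Y : Type*} [AddCommGroup X]

/-- The conceptual wiretap code with codebook `u` and decoder `g`. -/
def wiretapCode {n L L₁ : ℕ} [Nonempty (Fin L)] [Nonempty (Fin L₁)] (u : Fin L × Fin L₁ → Fin n → X)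
    (g : (Fin n → Y) → (Fin n → X) → Fin L) : Code X Y n L where
  enc := wiretapEnc u
  dec := fun y f => PMF.pure (g y f)

lemma isConceptualWiretap_wiretapCode {n L L₁ : ℕ} [Nonempty (Fin L)] [Nonempty (Fin L₁)]
    (u : Fin L × Fin L₁ → Fin n → X) (g : (Fin n → Y) → (Fin n → X) → Fin L) :
    IsConceptualWiretap (wiretapCode u g) :=
  ⟨L₁, inferInstance, u, g, fun _ => rfl, fun _ _ => rfl⟩

end WiretapCode

/-! ### Moments of the likelihood ratio factor over blocks -/

section RatioPower

variable {X : Type*} [Fintype X]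

lemma ratio_pairPow {B : Type*} [Fintype B] (p : PMF (X × B)) (n : ℕ)
    (s : (Fin n → X) × (Fin n → B)) : ratio (pairPow p n) s = ∏ i, ratio p (s.1 i, s.2 i) := by
  simp only [ratio, Finset.prod_div_distrib, Finset.prod_mul_distrib, Finset.prod_const,
    Finset.card_univ, Fintype.card_fin]
  rw [pairPow_map_snd, toReal_pairPow_apply, toReal_iid_apply, Fintype.card_fun, Fintype.card_fin,
    Nat.cast_pow]

lemma expect_threshold_div_ratio_pairPow {B : Type*} [Fintype B] (p : PMF (X × B)) (n : ℕ)
    {a : ℝ} (ha : 0 ≤ a) (s : ℝ) :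
    expect (pairPow p n) (fun v => (a ^ n / ratio (pairPow p n) v) ^ s) =
      expect p (fun v => (a / ratio p v) ^ s) ^ n := by
  rw [← expect_pairPow_prod]
  congr 1; funext v
  rw [Real.finsetProd_rpow _ _ fun i _ => div_nonneg ha (ratio_nonneg _ _), ratio_pairPow,
    Finset.prod_div_distrib]
  simp

lemma expect_ratio_div_pairPow {B : Type*} [Fintype B] (p : PMF (X × B)) (n : ℕ)
    {a : ℝ} (ha : 0 ≤ a) (s : ℝ) :
    expect (pairPow p n) (fun v => (ratio (pairPow p n) v / a ^ n) ^ s) =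
      expect p (fun v => (ratio p v / a) ^ s) ^ n := by
  rw [← expect_pairPow_prod]
  congr 1; funext v
  rw [Real.finsetProd_rpow _ _ fun i _ => div_nonneg (ratio_nonneg _ _) ha, ratio_pairPow,
    Finset.prod_div_distrib]
  simp

lemma natCast_ceil_le_two_mul {x : ℝ} (hx : 1 ≤ x) : (⌈x⌉₊ : ℝ) ≤ 2 * x := by
  have := Nat.ceil_lt_add_one (by linarith : 0 ≤ x)
  linarith

end RatioPower

section Achievability

variable {X Y Z : Type*} [Fintype X] [Fintype Y] [Fintype Z] [AddCommGroup X]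

lemma meaninglessLaw_eq (P : PMF (X × Y × Z)) (n : ℕ) :
    meaninglessLaw P n = maskedLaw (pairPow (lawXZ P) n) := by
  rw [meaninglessLaw, maskedLaw, pairPow, lawXZ, ← iid_map, PMF.map_comp, PMF.bind_map]
  rfl

lemma entropy_uniformOfFintype {α : Type*} [Fintype α] [Nonempty α] :
    entropy (PMF.uniformOfFintype α) = Real.logb 2 (Fintype.card α) := by
  have h : (Fintype.card α : ℝ) ≠ 0 := Nat.cast_ne_zero.2 Fintype.card_ne_zero
  simp [entropy, Real.negMulLog, Real.logb]
  field_simp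

lemma meets_wiretapCode {n L L₁ : ℕ} [Nonempty (Fin L)] [Nonempty (Fin L₁)]
    {P : PMF (X × Y × Z)} {u : Fin L × Fin L₁ → Fin n → X}
    {g : (Fin n → Y) → (Fin n → X) → Fin L} {ε : ℝ} (hε : 0 ≤ ε)
    (herr : errorProb (pairPow (lawXY P) n) (wiretapEnc u) (fun y f => PMF.pure (g y f)) ≤ ε)
    (hsec : secrecyLoss (pairPow (lawXZ P) n) u ≤ ε * Real.log 2) :
    Meets P (wiretapCode u g) ε where
  error := by
    rw [error_eq]
    exact ENNReal.ofReal_le_ofReal herr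
  uniformity := by
    rw [keyLaw_eq, keyWillieLaw_eq, wiretapCode, observedLaw_wiretapEnc_map_fst,
      entropy_uniformOfFintype, Fintype.card_fin, sub_self]
    exact hε
  effectiveSecrecy := by
    have hl2 : 0 < Real.log 2 := Real.log_pos one_lt_two
    have h1 : ∀ w, observedLaw (pairPow (lawXZ P) n) (wiretapEnc u) w ≠ 0 →
        prodLaw ((observedLaw (pairPow (lawXZ P) n) (wiretapEnc u)).map Prod.fst)
          ((observedLaw (pairPow (lawXZ P) n) (wiretapEnc u)).map Prod.snd) w ≠ 0 := by
      rintro ⟨a, b⟩ hs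
      rw [prodLaw_apply]
      exact mul_ne_zero (map_apply_ne_zero _ Prod.fst hs) (map_apply_ne_zero _ Prod.snd hs)
    have h2 : ∀ b, (observedLaw (pairPow (lawXZ P) n) (wiretapEnc u)).map Prod.snd b ≠ 0 →
        maskedLaw (pairPow (lawXZ P) n) b ≠ 0 := fun b => maskedLaw_apply_ne_zero
    rw [willieLaw_eq, keyLaw_eq, keyWillieLaw_eq, meaninglessLaw_eq, wiretapCode,
      divergence_eq_ofReal h1, divergence_eq_ofReal h2,
      ← ENNReal.ofReal_add (div_nonneg (relEntropy_nonneg h1) hl2.le)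
        (div_nonneg (relEntropy_nonneg h2) hl2.le), ← add_div, ← secrecyLoss_eq]
    exact ENNReal.ofReal_le_ofReal ((div_le_iff₀ hl2).2 hsec)

/-- Publishing the source masked by a uniform sequence achieves rate zero. -/
lemma achievable_zero (P : PMF (X × Y × Z)) :
    Achievable (fun _ _ => {c | IsConceptualWiretap c}) P 0 := by
  intro ε hε
  refine ⟨0, fun n _ => ?_⟩
  rw [mul_zero, Real.rpow_zero, Nat.ceil_one]
  have : Nonempty (Fin (Fintype.card (Fin n → X))) := Fin.pos_iff_nonempty.1 Fintype.card_pos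
  -- There is a single key, and the codebook runs through every sequence exactly once, so the
  -- average in `secrecyLoss` is exactly 1.
  set e := (Fintype.equivFin (Fin n → X)).symm
  refine ⟨wiretapCode (fun i : Fin 1 × _ => e i.2) (fun _ _ => 0),
    isConceptualWiretap_wiretapCode _ _, meets_wiretapCode hε.le ?_ ?_⟩
  · have h : ∀ a b : Fin 1, ¬ a ≠ b := fun a b h => h (Subsingleton.elim a b)
    simp only [errorProb, if_neg (h _ _), expect_const]
    exact hε.le
  · refine le_trans (le_of_eq ?_) (mul_nonneg hε.le (Real.log_nonneg one_le_two))
    rw [secrecyLoss, ← expect_const (pairPow (lawXZ P) n) 0]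
    refine expect_congr fun s hs => ?_
    rw [← expect_const (PMF.uniformOfFintype (Fin 1 × Fin (Fintype.card (Fin n → X)))) 0]
    congr 1; funext i
    have h := expect_ratio (map_apply_ne_zero (pairPow (lawXZ P) n) Prod.snd hs)
    rw [expect_uniform, ← Equiv.sum_comp (e.trans (Equiv.subLeft (e i.2 + s.1)))] at h
    simp only [Equiv.trans_apply, Equiv.subLeft_apply] at h
    rw [Fintype.card_fin, h, Real.log_one]

/-- Rates below the difference of the two information rates of the conceptual wiretap channel are
achieved by conceptual wiretap codes. -/
theorem achievable_of_lt {P : PMF (X × Y × Z)} {R : ℝ} (hR : 0 ≤ R)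
    (h : R * Real.log 2 < expect (lawXY P) (fun s => Real.log (ratio (lawXY P) s)) -
      expect (lawXZ P) (fun s => Real.log (ratio (lawXZ P) s))) :
    Achievable (fun _ _ => {c | IsConceptualWiretap c}) P R := by
  have hl2 : 0 < Real.log 2 := Real.log_pos one_lt_two
  set p := lawXY P
  set q := lawXZ P
  set iY := expect p fun s => Real.log (ratio p s) with hiY
  set iZ := expect q fun s => Real.log (ratio q s) with hiZ
  have hiZ0 : 0 ≤ iZ := expect_log_ratio_nonneg q
  set ρ := R * Real.log 2 with hρ
  have hρ0 : 0 ≤ ρ := mul_nonneg hR hl2.le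
  -- Exponents in nats: key ρ, randomization iZ + δ, threshold ρ + iZ + 2δ = iY - δ. Each of the
  -- three error terms thus keeps a margin δ.
  set δ := (iY - iZ - ρ) / 3 with hδ
  have hδ0 : 0 < δ := by rw [hδ]; linarith
  obtain ⟨s, hs0, -, hs⟩ := exists_expect_rpow_lt_one (p := p)
    (φ := fun v => Real.exp (ρ + iZ + 2 * δ) / ratio p v)
    (fun v hv => div_pos (Real.exp_pos _) (ratio_pos hv)) (by
      rw [expect_congr fun v hv => by
        rw [Real.log_div (Real.exp_pos _).ne' (ratio_pos hv).ne', Real.log_exp],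
        expect_sub, expect_const, ← hiY]
      linarith)
  obtain ⟨t, ht0, ht1, ht⟩ := exists_expect_rpow_lt_one (p := q)
    (φ := fun v => ratio q v / Real.exp (iZ + δ))
    (fun v hv => div_pos (ratio_pos hv) (Real.exp_pos _)) (by
      rw [expect_congr fun v hv => by
        rw [Real.log_div (ratio_pos hv).ne' (Real.exp_pos _).ne', Real.log_exp],
        expect_sub, expect_const, ← hiZ]
      linarith)
  set α := expect p fun v => (Real.exp (ρ + iZ + 2 * δ) / ratio p v) ^ s with hα
  set γ := expect q fun v => (ratio q v / Real.exp (iZ + δ)) ^ t with hγ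
  have hα0 : 0 ≤ α := expect_nonneg fun v _ =>
    Real.rpow_nonneg (div_nonneg (Real.exp_pos _).le (ratio_nonneg _ _)) _
  have hγ0 : 0 ≤ γ := expect_nonneg fun v _ =>
    Real.rpow_nonneg (div_nonneg (ratio_nonneg _ _) (Real.exp_pos _).le) _
  have hlim : Filter.Tendsto (fun n : ℕ => α ^ n + 4 * Real.exp (-δ) ^ n + γ ^ n / t) Filter.atTop
      (nhds 0) := by
    have h1 := tendsto_pow_atTop_nhds_zero_of_lt_one hα0 hs
    have h2 := tendsto_pow_atTop_nhds_zero_of_lt_one (Real.exp_pos (-δ)).le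
      (by simpa using hδ0)
    have h3 := tendsto_pow_atTop_nhds_zero_of_lt_one hγ0 ht
    simpa using (h1.add (h2.const_mul 4)).add (h3.div_const t)
  intro ε hε
  obtain ⟨n₀, hn₀⟩ := Filter.eventually_atTop.1
    (hlim.eventually_le_const (mul_pos hε hl2))
  refine ⟨n₀, fun n hn => ?_⟩
  have hL : (2 : ℝ) ^ ((n : ℝ) * R) = Real.exp ρ ^ n := by
    rw [Real.rpow_def_of_pos two_pos, ← Real.exp_nat_mul]
    congr 1
    ring
  rw [hL]
  have hL1 : 1 ≤ Real.exp ρ ^ n := one_le_pow₀ (Real.one_le_exp hρ0)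
  have hJ1 : 1 ≤ Real.exp (iZ + δ) ^ n := one_le_pow₀ (Real.one_le_exp (by linarith))
  have : Nonempty (Fin ⌈Real.exp ρ ^ n⌉₊) :=
    Fin.pos_iff_nonempty.1 (Nat.ceil_pos.2 (by linarith))
  have : Nonempty (Fin ⌈Real.exp (iZ + δ) ^ n⌉₊) :=
    Fin.pos_iff_nonempty.1 (Nat.ceil_pos.2 (by linarith))
  obtain ⟨u, g, hug⟩ := exists_codebook (Fin ⌈Real.exp ρ ^ n⌉₊) (Fin ⌈Real.exp (iZ + δ) ^ n⌉₊)
    (pairPow p n) (pairPow q n) (pow_pos (Real.exp_pos (ρ + iZ + 2 * δ)) n) hs0 ht0 ht1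
  have hbound : errorProb (pairPow p n) (wiretapEnc u) (fun y f => PMF.pure (g y f)) +
      secrecyLoss (pairPow q n) u ≤ ε * Real.log 2 := by
    refine hug.trans (le_trans (add_le_add (add_le_add ?_ ?_) ?_) (hn₀ n hn))
    · rw [expect_threshold_div_ratio_pairPow p n (Real.exp_pos _).le]
    -- Each of the two ceilings costs a factor 2, which gives the 4; the threshold exceeds the
    -- product of the two unrounded sizes by exp δ per letter.
    · rw [Fintype.card_fin, Fintype.card_fin, div_le_iff₀ (pow_pos (Real.exp_pos _) n)]
      refine (mul_le_mul (natCast_ceil_le_two_mul hL1) (natCast_ceil_le_two_mul hJ1)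
        (Nat.cast_nonneg _) (by positivity)).trans (le_of_eq ?_)
      rw [mul_mul_mul_comm, ← mul_pow, ← Real.exp_add, mul_assoc 4, ← mul_pow, ← Real.exp_add]
      ring_nf
    · refine div_le_div_of_nonneg_right ?_ ht0.le
      rw [hγ, ← expect_ratio_div_pairPow q n (Real.exp_pos _).le, Fintype.card_fin]
      refine expect_mono fun v _ => Real.rpow_le_rpow (div_nonneg (ratio_nonneg _ _)
        (Nat.cast_nonneg _)) (div_le_div_of_nonneg_left (ratio_nonneg _ _) (by linarith)
          (Nat.le_ceil _)) ht0.le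
  have hE := errorProb_nonneg (pairPow p n) (wiretapEnc u) fun y f => PMF.pure (g y f)
  have hS := secrecyLoss_nonneg (pairPow q n) u
  -- The common bound ε log 2, needed to convert the secrecy loss to bits, is then also at most ε
  -- for the error.
  have hl2' : Real.log 2 ≤ 1 := by
    have := Real.log_le_sub_one_of_pos two_pos
    linarith
  refine ⟨wiretapCode u g, isConceptualWiretap_wiretapCode u g, meets_wiretapCode hε.le ?_ ?_⟩
  · have := mul_le_of_le_one_right hε.le hl2'
    linarith
  · linarith

/-- The mean log-ratios are log |X| - H(X | Y) and log |X| - H(X | Z), so log |X| cancels in the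
difference. -/
lemma expect_log_ratio_sub (P : PMF (X × Y × Z)) :
    expect (lawXY P) (fun s => Real.log (ratio (lawXY P) s)) -
      expect (lawXZ P) (fun s => Real.log (ratio (lawXZ P) s)) =
      (mutualInfo (lawXY P) - mutualInfo (lawXZ P)) * Real.log 2 := by
  rw [← expect_log_degradedRatio]
  conv_lhs => rw [lawXY, expect_map, ← lawXY, lawXZ, expect_map, ← lawXZ]
  rw [← expect_sub]
  refine expect_congr fun s hs => ?_
  obtain ⟨h1, h2, -, -⟩ := law_apply_ne_zero P hs
  rw [← Real.log_div (ratio_pos h1).ne' (ratio_pos h2).ne']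
  have e2 : (lawXY P).map Prod.snd = lawY P := by rw [lawXY, PMF.map_comp]; rfl
  have hX : (Fintype.card X : ℝ) ≠ 0 := Nat.cast_ne_zero.2 Fintype.card_ne_zero
  congr 1
  rw [ratio, ratio, degradedRatio, e2]
  field_simp

end Achievability

end SSKG

end

theorem theorem2 {X Y Z : Type*} [Fintype X] [Fintype Y] [Fintype Z] [AddCommGroup X]
    (P' P : PMF (X × Y × Z)) (h : SSKG.StochasticallyDegradedVia P' P) :
    SSKG.IsStealthyKeyCapacity (fun _ _ => Set.univ) P'
        (SSKG.mutualInfo (SSKG.lawXY P) - SSKG.mutualInfo (SSKG.lawXZ P)) ∧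
      SSKG.IsStealthyKeyCapacity (fun _ _ => {c | SSKG.IsConceptualWiretap c}) P'
        (SSKG.mutualInfo (SSKG.lawXY P) - SSKG.mutualInfo (SSKG.lawXZ P)) := by
  have hach : ∀ R : ℝ, 0 ≤ R →
      R < SSKG.mutualInfo (SSKG.lawXY P) - SSKG.mutualInfo (SSKG.lawXZ P) →
      SSKG.Achievable (fun _ _ => {c | SSKG.IsConceptualWiretap c}) P' R := by
    intro R hR hlt
    refine SSKG.achievable_of_lt hR ?_
    rw [SSKG.expect_log_ratio_sub, h.lawXY_eq, h.lawXZ_eq]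
    exact mul_lt_mul_of_pos_right hlt (Real.log_pos one_lt_two)
  -- The converse covers all codes and achievability uses wiretap codes only, so every class between
  -- the two has the same capacity.
  have hlub : ∀ A : ∀ n L : ℕ, Set (SSKG.Code X Y n L),
      (∀ n L, {c | SSKG.IsConceptualWiretap c} ⊆ A n L) →
      SSKG.IsStealthyKeyCapacity A P'
        (SSKG.mutualInfo (SSKG.lawXY P) - SSKG.mutualInfo (SSKG.lawXZ P)) := by
    intro A hA
    have hmono : ∀ R, SSKG.Achievable (fun _ _ => {c | SSKG.IsConceptualWiretap c}) P' R →
        SSKG.Achievable A P' R := by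
      intro R hR ε hε
      obtain ⟨n₀, hn₀⟩ := hR ε hε
      exact ⟨n₀, fun n hn => let ⟨c, hc, hm⟩ := hn₀ n hn; ⟨c, hA _ _ hc, hm⟩⟩
    refine ⟨fun R hR => SSKG.Achievable.le h hR.1 hR.2, fun b hb => ?_⟩
    -- Rate zero makes every upper bound nonnegative, so a rate chosen between b and the claimed
    -- capacity is admissible.
    have hb0 : 0 ≤ b := hb ⟨le_rfl, hmono 0 (SSKG.achievable_zero P')⟩
    by_contra! hlt
    obtain ⟨R, hbR, hRC⟩ := exists_between hlt
    have hR0 : 0 ≤ R := hb0.trans hbR.le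
    exact hbR.not_ge (hb ⟨hR0, hmono R (hach R hR0 hRC)⟩)
  exact ⟨hlub _ fun _ _ => Set.subset_univ _, hlub _ fun _ _ => subset_rfl⟩
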